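/- Fix an arbitrary norm $\|\cdot\|$ on $\mathbb{R}^d$. Let $(X_t)_{t\in\mathbb{Z}}$ be a (strictly) stationary process in $\mathbb{R}^d$ and let $\alpha\in(0,\infty)$. A random vector $Z$ in $\mathbb{R}^m$ is called regularly varying of index $\alpha$ if, for some norm $|\cdot|$ on $\mathbb{R}^m$, there is a random vector $\Theta$ on the unit sphere $\{z : |z|=1\}$ such that for every $u\in(0,\infty)$, as $x\to\infty$, \[ \frac{\Pr(|Z|>ux,\ Z/|Z|\in\cdot\,)}{\Pr(|Z|>x)}\;\to\;u^{-\alpha}\,\Pr(\Theta\in\cdot\,) \] in the sense of weak convergence of finite measures. The process $(X_t)_{t\in\mathbb{Z}}$ is called jointly regularly varying of index $\alpha$ if, for every positive integer $k$, the $kd$-dimensional random vector $(X_1,\dots,X_k)$ is regularly varying of index $\alpha$. The following three statements are equivalent (convergence of laws being weak convergence). (i) $(X_t)_{t\in\mathbb{Z}}$ is jointly regularly varying of index $\alpha$. (ii) There exists a process $(Y_t)_{t\in\mathbb{N}}$ in $\mathbb{R}^d$, where $\mathbb{N}=\{0,1,2,\dots\}$, with $\Pr(\|Y_0\|>y)=y^{-\alpha}$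 for $y\ge 1$, such that for every $t\in\mathbb{N}$, as $x\to\infty$, \[ \mathcal{L}\bigl(x^{-1}X_0,\dots,x^{-1}X_t \,\big|\, \|X_0\|>x\bigr)\;\to\;\mathcal{L}(Y_0,\dots,Y_t). \] (iii) There exists a process $(Y_t)_{t\in\mathbb{Z}}$ in $\mathbb{R}^d$ with $\Pr(\|Y_0\|>y)=y^{-\alpha}$ for $y\ge 1$, such that for all $s,t\in\mathbb{Z}$ with $s\le t$, as $x\to\infty$, \[ \mathcal{L}\bigl(x^{-1}X_s,\dots,x^{-1}X_t \,\big|\, \|X_0\|>x\bigr)\;\to\;\mathcal{L}(Y_s,\dots,Y_t). \] A process $(Y_t)_{t\in\mathbb{Z}}$ as in (iii) is called the tail process of $(X_t)_{t\in\mathbb{Z}}$. In (ii) and (iii), the convergence is understood to include that $\Pr(\|X_0\|>x)>0$ for all $x$, and in the definition of regular variation that $\Pr(|Z|>x)>0$ for all $x$, so that the conditional laws and quotients are defined. -/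

import Mathlib

open Filter Topology MeasureTheory ProbabilityTheory

/-- A seminorm on a real vector space is a norm if it vanishes only at the origin. -/
def IsNorm {V : Type*} [AddCommGroup V] [Module ℝ V] (p : Seminorm ℝ V) : Prop :=
  ∀ v : V, p v = 0 → v = 0

/-- The image of a finite measure `P` under `Z`, as a finite measure; if `P` is a probability
measure, this is the law of the random element `Z`. The topology on `FiniteMeasure V` is that of
weak convergence (convergence of the integrals of bounded continuous functions). -/
noncomputable def finiteLaw {Ω V : Type*} [MeasurableSpace Ω] [MeasurableSpace V]
    (P : Measure Ω) [IsFiniteMeasure P] (Z : Ω → V) : FiniteMeasure V :=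
  ⟨P.map Z, inferInstance⟩

/-- Strict stationarity of a process indexed by `ℤ`: the law of the process, as a random element
of the space of sequences with the product sigma-algebra, is invariant under all time shifts. -/
def IsStrictlyStationary {Ω E : Type*} [MeasurableSpace Ω] [MeasurableSpace E]
    (P : Measure Ω) (X : ℤ → Ω → E) : Prop :=
  ∀ h : ℤ, P.map (fun ω (t : ℤ) => X (t + h) ω) = P.map (fun ω (t : ℤ) => X t ω)

/-- Multivariate regular variation of index `α` of the random vector `Z` with values in the
finite-dimensional real space `V`: for some norm `p` on `V` there is a probability measure `σ`
(the law of `Θ`) on the unit sphere of `p` such that, for every `u > 0`, the finite measures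
`ℙ(p Z > u x, Z / p Z ∈ ·) / ℙ(p Z > x)` converge weakly to `u ^ (-α) σ` as `x → ∞`.
(Measures on the unit sphere are regarded as measures on `V` carried by this closed subset. If
`ℙ(p Z > x) = 0` for some `x`, then the left-hand side is eventually zero and the condition fails.)
-/
def IsRegularlyVarying {Ω V : Type*} [MeasurableSpace Ω]
    [AddCommGroup V] [Module ℝ V] [TopologicalSpace V] [MeasurableSpace V] [OpensMeasurableSpace V]
    (P : Measure Ω) [IsProbabilityMeasure P] (Z : Ω → V) (α : ℝ) : Prop :=
  ∃ p : Seminorm ℝ V, IsNorm p ∧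
    ∃ σ : ProbabilityMeasure V, σ {v : V | p v = 1} = 1 ∧
      ∀ u : ℝ, 0 < u →
        Tendsto
          (fun x : ℝ => (P {ω | x < p (Z ω)}).toNNReal⁻¹ •
            finiteLaw (P.restrict {ω | u * x < p (Z ω)}) (fun ω => (p (Z ω))⁻¹ • Z ω))
          atTop
          (𝓝 ((u ^ (-α)).toNNReal • σ.toFiniteMeasure))

/-- Joint regular variation of index `α` of a time series in `ℝ^d`: for every `k ≥ 1` the
`kd`-dimensional vector `(X_1, …, X_k)` is regularly varying of index `α`. -/
def IsJointlyRegularlyVarying {Ω : Type*} [MeasurableSpace Ω] {d : ℕ}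
    (P : Measure Ω) [IsProbabilityMeasure P] (X : ℤ → Ω → (Fin d → ℝ)) (α : ℝ) : Prop :=
  ∀ k : ℕ, 1 ≤ k →
    IsRegularlyVarying P (fun ω (i : Fin k) => X (((i : ℕ) : ℤ) + 1) ω) α

/-- The conditional law of `(X_{τ i} / x)_{i ∈ ι}` given `‖X_0‖ > x`, for the norm `ν`, with
Mathlib's elementary conditional probability. (If the conditioning event has probability zero, this
is the zero measure; a family that is eventually zero does not converge to a probability.) -/
noncomputable def exceedanceLaw {Ω ι : Type*} [MeasurableSpace Ω] {d : ℕ}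
    (P : Measure Ω) (ν : Seminorm ℝ (Fin d → ℝ)) (X : ℤ → Ω → (Fin d → ℝ))
    (τ : ι → ℤ) (x : ℝ) : FiniteMeasure (ι → Fin d → ℝ) :=
  finiteLaw (P[|{ω | x < ν (X 0 ω)}]) (fun ω i => x⁻¹ • X (τ i) ω)

/-- `Z` has the Pareto tail `ℙ(‖Z‖ > y) = y ^ (-α)` for `y ≥ 1`. -/
def HasParetoNorm {Ω : Type*} [MeasurableSpace Ω] {d : ℕ}
    (Q : Measure Ω) (ν : Seminorm ℝ (Fin d → ℝ)) (Z : Ω → (Fin d → ℝ)) (α : ℝ) : Prop :=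
  ∀ y : ℝ, 1 ≤ y → Q {ω | y < ν (Z ω)} = ENNReal.ofReal (y ^ (-α))

/-- `(Y_t)_{t ∈ ℕ}` is a forward tail process of `X`: a process in `ℝ^d` with
`ℙ(‖Y_0‖ > y) = y ^ (-α)` for `y ≥ 1`, such that for every `t ∈ ℕ` the law of
`(X_0 / x, …, X_t / x)` given `‖X_0‖ > x` converges weakly to that of `(Y_0, …, Y_t)`. -/
def IsForwardTailProcess {Ω Ω' : Type*} [MeasurableSpace Ω] [MeasurableSpace Ω'] {d : ℕ}
    (P : Measure Ω) (ν : Seminorm ℝ (Fin d → ℝ)) (X : ℤ → Ω → (Fin d → ℝ)) (α : ℝ)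
    (Q : Measure Ω') [IsProbabilityMeasure Q] (Y : ℕ → Ω' → (Fin d → ℝ)) : Prop :=
  (∀ t, Measurable (Y t)) ∧ HasParetoNorm Q ν (Y 0) α ∧
    ∀ t : ℕ,
      Tendsto (exceedanceLaw P ν X (fun i : Fin (t + 1) => ((i : ℕ) : ℤ))) atTop
        (𝓝 (finiteLaw Q (fun ω (i : Fin (t + 1)) => Y i ω)))

/-- `(Y_t)_{t ∈ ℤ}` is a tail process of `X`: a process in `ℝ^d` with
`ℙ(‖Y_0‖ > y) = y ^ (-α)` for `y ≥ 1`, such that for all integers `s ≤ t` the law of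
`(X_s / x, …, X_t / x)` given `‖X_0‖ > x` converges weakly to that of `(Y_s, …, Y_t)`. -/
def IsTailProcess {Ω Ω' : Type*} [MeasurableSpace Ω] [MeasurableSpace Ω'] {d : ℕ}
    (P : Measure Ω) (ν : Seminorm ℝ (Fin d → ℝ)) (X : ℤ → Ω → (Fin d → ℝ)) (α : ℝ)
    (Q : Measure Ω') [IsProbabilityMeasure Q] (Y : ℤ → Ω' → (Fin d → ℝ)) : Prop :=
  (∀ t, Measurable (Y t)) ∧ HasParetoNorm Q ν (Y 0) α ∧
    ∀ s t : ℤ, s ≤ t →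
      Tendsto (exceedanceLaw P ν X (fun i : Finset.Icc s t => (i : ℤ))) atTop
        (𝓝 (finiteLaw Q (fun ω (i : Finset.Icc s t) => Y i ω)))

set_option linter.unusedSectionVars false

/-! ### Existence of limits by approximation -/

/-! Write `G x` for the tail of `‖X_0‖`. All three statements are compared with
`HasBlockTailLimits`: `G` is regularly varying, and for every block `Z` and every bounded continuous
`f` vanishing near the origin, the mean of `f (Z / x)` divided by `G x` converges. Only existence of
limits is asserted, so completeness of `ℝ` and uniform approximation suffice and no limit measure on
the punctured space is built.

From joint regular variation, `HasTailLimits.of_polar` cuts a compactly supported `f` into thin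
radial shells, on which it is nearly a function of the direction alone. Each block comes with its
own norm and normaliser; stationarity and a union bound show that this normaliser is asymptotically
proportional to `G`.

From tail limits to the tail process, conditioning on `‖X_0‖ > x` amounts to a test function with a
jump, which `HasTailLimits.indicator` admits because thin shells have small limiting mass. A
geometric tail bound makes the conditional laws of whole rescaled paths tight in the product space.
The coordinate process under a cluster point is the tail process, since every finite-dimensional
integral already converges; consistency is automatic.

From a forward tail process back to tail limits, `sum_zeroInit` telescopes `f` by erasing the
entries of a block one at a time. The `i`-th increment involves no entry before `i` and is small
when entry `i` is small; when entry `i` is large, stationarity moves it to time zero and the forward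
limit applies. Finally, tail limits give regular variation: the directional laws live on a compact
sphere, and any cluster point is the spectral law. -/

theorem exists_tendsto_of_approx {F : ℝ → ℝ}
    (h : ∀ ε > 0, ∃ H : ℝ → ℝ, (∃ l, Tendsto H atTop (𝓝 l)) ∧ ∀ᶠ x in atTop, |F x - H x| ≤ ε) :
    ∃ l, Tendsto F atTop (𝓝 l) := by
  -- The limit of `F` is never identified: the limits of the approximants `H` only serve to show
  -- that the image filter is Cauchy.
  rw [← cauchy_map_iff_exists_tendsto, Metric.cauchy_iff]
  refine ⟨inferInstance, fun ε hε => ?_⟩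
  obtain ⟨H, ⟨l, hl⟩, hH⟩ := h (ε / 4) (by positivity)
  have hl' := Metric.tendsto_nhds.1 hl (ε / 4) (by positivity)
  refine ⟨{y | |y - l| < ε / 2}, ?_, fun x hx y hy => ?_⟩
  · rw [mem_map]
    filter_upwards [hl', hH] with x h1 h2
    rw [Real.dist_eq] at h1
    have := abs_sub_le (F x) (H x) l
    simp only [Set.mem_preimage, Set.mem_ofPred_eq]
    linarith
  · simp only [Set.mem_ofPred_eq] at hx hy
    rw [Real.dist_eq]
    have := abs_sub_le x l y
    rw [abs_sub_comm l y] at this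
    linarith

/-! ### Norms on finite-dimensional spaces -/

section Norms

variable {V : Type*} [NormedAddCommGroup V] [NormedSpace ℝ V] [FiniteDimensional ℝ V]

theorem Seminorm.continuous_of_finiteDimensional (p : Seminorm ℝ V) : Continuous p := by
  have := p.convexOn.continuousOn isOpen_univ
  exact continuousOn_univ.1 this

theorem Seminorm.exists_le_mul_norm (p : Seminorm ℝ V) : ∃ C, 0 < C ∧ ∀ v, p v ≤ C * ‖v‖ :=
  p.bound_of_continuous_normedSpace p.continuous_of_finiteDimensional

theorem IsNorm.exists_mul_norm_le {p : Seminorm ℝ V} (hp : IsNorm p) :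
    ∃ c, 0 < c ∧ ∀ v, c * ‖v‖ ≤ p v := by
  rcases (Metric.sphere (0 : V) 1).eq_empty_or_nonempty with h | h
  · refine ⟨1, one_pos, fun v => ?_⟩
    by_cases hv : v = 0
    · simp [hv]
    · have : (‖v‖⁻¹ • v) ∈ Metric.sphere (0 : V) 1 := by
        simp [norm_smul, inv_mul_cancel₀ (norm_ne_zero_iff.2 hv)]
      simp [h] at this
  · obtain ⟨w, hw, hmin⟩ := (isCompact_sphere (0 : V) 1).exists_isMinOn h
      p.continuous_of_finiteDimensional.continuousOn
    have hw1 : ‖w‖ = 1 := by simpa using hw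
    have hpos : 0 < p w := by
      refine lt_of_le_of_ne (apply_nonneg p w) fun h0 => ?_
      rw [hp w h0.symm] at hw1
      simp at hw1
    refine ⟨p w, hpos, fun v => ?_⟩
    by_cases hv : v = 0
    · simp [hv]
    · have hv' : 0 < ‖v‖ := norm_pos_iff.2 hv
      have : (‖v‖⁻¹ • v) ∈ Metric.sphere (0 : V) 1 := by
        simp [norm_smul, inv_mul_cancel₀ hv'.ne']
      have h2 : p w ≤ p (‖v‖⁻¹ • v) := hmin this
      rw [map_smul_eq_mul, Real.norm_of_nonneg (by positivity), inv_mul_eq_div,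
        le_div_iff₀ hv'] at h2
      exact h2

theorem IsNorm.isCompact_sphere {p : Seminorm ℝ V} (hp : IsNorm p) :
    IsCompact {v : V | p v = 1} := by
  obtain ⟨c, hc, h⟩ := hp.exists_mul_norm_le
  refine Metric.isCompact_of_isClosed_isBounded
    (isClosed_eq p.continuous_of_finiteDimensional continuous_const) ?_
  refine (Metric.isBounded_closedBall (x := (0 : V)) (r := c⁻¹)).subset fun v hv => ?_
  rw [mem_closedBall_zero_iff, ← one_div, le_div_iff₀ hc, mul_comm]
  exact (h v).trans (le_of_eq hv)

end Norms

/-! ### Regularly varying tails -/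

/-- The tail function `G` is regularly varying of index `-α`. -/
def TailRV (G : ℝ → ℝ) (α : ℝ) : Prop :=
  ∀ c : ℝ, 0 < c → Tendsto (fun x => G (c * x) / G x) atTop (𝓝 (c ^ (-α)))

/-- Division by zero gives `0`, whereas `G x / G x` must tend to `1`. -/
theorem TailRV.eventually_ne {G : ℝ → ℝ} {α : ℝ} (h : TailRV G α) :
    ∀ᶠ x in atTop, G x ≠ 0 := by
  have h1 := h 1 one_pos
  rw [Real.one_rpow] at h1
  filter_upwards [h1.eventually_ne one_ne_zero] with x hx h0
  simp [h0] at hx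

theorem TailRV.eventually_ne_mul {G : ℝ → ℝ} {α : ℝ} (h : TailRV G α) {c : ℝ} (hc : 0 < c) :
    ∀ᶠ x in atTop, G (c * x) ≠ 0 :=
  (tendsto_id.const_mul_atTop hc).eventually h.eventually_ne

/-- A tail function asymptotically proportional to a regularly varying one is regularly varying. -/
theorem TailRV.of_ratio {G H : ℝ → ℝ} {α l : ℝ} (h : TailRV G α) (hl : l ≠ 0)
    (hH : Tendsto (fun x => H x / G x) atTop (𝓝 l)) : TailRV H α := by
  intro c hc
  have h1 : Tendsto (fun x => H (c * x) / G (c * x)) atTop (𝓝 l) :=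
    hH.comp (tendsto_id.const_mul_atTop hc)
  have h2 := (h1.mul (h c hc)).div hH hl
  rw [mul_div_assoc, mul_div_cancel₀] at h2
  · refine h2.congr' ?_
    filter_upwards [h.eventually_ne, h.eventually_ne_mul hc] with x hx hcx
    by_cases h0 : H x = 0
    · simp [h0]
    · simp only [Pi.div_apply]
      field_simp
  · exact hl

theorem exists_mul_rpow_neg_le {α : ℝ} (hα : 0 < α) {K ε : ℝ} (hε : 0 < ε) :
    ∃ M, 0 < M ∧ ∀ M' ≥ M, K * M' ^ (-α) < ε := by
  have h : Tendsto (fun M : ℝ => K * M ^ (-α)) atTop (𝓝 (K * 0)) :=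
    (tendsto_rpow_neg_atTop hα).const_mul K
  rw [mul_zero] at h
  obtain ⟨M, hM⟩ := ((h.eventually_lt_const hε).and (eventually_gt_atTop 0)).exists_forall_of_atTop
  exact ⟨M, (hM M le_rfl).2, fun M' h => (hM M' h).1⟩

/-! ### Scaled means -/

section ScaledMean

variable {Ω V : Type*} [MeasurableSpace Ω]

/-- The upper tail of a real random variable. -/
noncomputable def upperTail (P : Measure Ω) (W : Ω → ℝ) (x : ℝ) : ℝ := P.real {ω | x < W ω}

theorem upperTail_nonneg (P : Measure Ω) (W : Ω → ℝ) (x : ℝ) : 0 ≤ upperTail P W x :=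
  measureReal_nonneg

theorem upperTail_anti (P : Measure Ω) [IsFiniteMeasure P] (W : Ω → ℝ) :
    Antitone (upperTail P W) := fun _ _ h =>
  measureReal_mono (fun _ hω => lt_of_le_of_lt h hω)

/-- Bounded measurable functions. -/
def BddMeas [MeasurableSpace V] (f : V → ℝ) : Prop :=
  Measurable f ∧ ∃ C, ∀ v, |f v| ≤ C

namespace BddMeas

variable [MeasurableSpace V] {f g : V → ℝ}

theorem add (hf : BddMeas f) (hg : BddMeas g) : BddMeas (fun v => f v + g v) := by
  obtain ⟨hf, C, hC⟩ := hf
  obtain ⟨hg, D, hD⟩ := hg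
  exact ⟨hf.add hg, C + D, fun v => (abs_add_le _ _).trans (add_le_add (hC v) (hD v))⟩

theorem sub (hf : BddMeas f) (hg : BddMeas g) : BddMeas (fun v => f v - g v) := by
  obtain ⟨hf, C, hC⟩ := hf
  obtain ⟨hg, D, hD⟩ := hg
  exact ⟨hf.sub hg, C + D, fun v => (abs_sub _ _).trans (add_le_add (hC v) (hD v))⟩

theorem const_mul (hf : BddMeas f) (c : ℝ) : BddMeas (fun v => c * f v) := by
  obtain ⟨hf, C, hC⟩ := hf
  exact ⟨hf.const_mul c, |c| * C, fun v => by
    rw [abs_mul]; exact mul_le_mul_of_nonneg_left (hC v) (abs_nonneg c)⟩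

theorem indicator (hf : BddMeas f) {s : Set V} (hs : MeasurableSet s) :
    BddMeas (s.indicator f) := by
  obtain ⟨hf, C, hC⟩ := hf
  refine ⟨hf.indicator hs, C, fun v => ?_⟩
  by_cases hv : v ∈ s
  · simpa [hv] using hC v
  · simpa [hv] using (abs_nonneg _).trans (hC v)

theorem const (c : ℝ) : BddMeas (fun _ : V => c) := ⟨measurable_const, |c|, fun _ => le_rfl⟩

theorem comp {W : Type*} [MeasurableSpace W] (hf : BddMeas f) {φ : W → V} (hφ : Measurable φ) :
    BddMeas (fun w => f (φ w)) :=
  ⟨hf.1.comp hφ, hf.2.imp fun _ h w => h (φ w)⟩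

theorem integrable (hf : BddMeas f) {P : Measure Ω} [IsFiniteMeasure P] {Z : Ω → V}
    (hZ : Measurable Z) : Integrable (fun ω => f (Z ω)) P := by
  obtain ⟨hf, C, hC⟩ := hf
  exact Integrable.of_bound (hf.comp hZ).aestronglyMeasurable C (ae_of_all _ fun ω => hC (Z ω))

end BddMeas

variable [NormedAddCommGroup V] [NormedSpace ℝ V]

/-- The mean of `f (Z / x)`, normalised by `G x`. -/
noncomputable def scaledMean (P : Measure Ω) (Z : Ω → V) (G : ℝ → ℝ) (f : V → ℝ) (x : ℝ) : ℝ :=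
  (∫ ω, f (x⁻¹ • Z ω) ∂P) / G x

/-- The normalised means of all bounded continuous functions vanishing near the origin converge. -/
def HasTailLimits (P : Measure Ω) (Z : Ω → V) (G : ℝ → ℝ) : Prop :=
  ∀ f : V → ℝ, Continuous f → (∃ C, ∀ v, |f v| ≤ C) → (∃ δ > 0, ∀ v, ‖v‖ < δ → f v = 0) →
    ∃ l, Tendsto (scaledMean P Z G f) atTop (𝓝 l)

variable [MeasurableSpace V] [BorelSpace V]
  {P : Measure Ω} [IsFiniteMeasure P] {Z : Ω → V} {G : ℝ → ℝ} {f g h : V → ℝ}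

theorem BddMeas.of_continuous (hf : Continuous f) (hC : ∃ C, ∀ v, |f v| ≤ C) : BddMeas f :=
  ⟨hf.measurable, hC⟩

theorem BddMeas.integrable_smul (hf : BddMeas f) (hZ : Measurable Z) (x : ℝ) :
    Integrable (fun ω => f (x⁻¹ • Z ω)) P :=
  hf.integrable (hZ.const_smul x⁻¹)

theorem scaledMean_sub (hf : BddMeas f) (hg : BddMeas g) (hZ : Measurable Z) (x : ℝ) :
    scaledMean P Z G (fun v => f v - g v) x = scaledMean P Z G f x - scaledMean P Z G g x := by
  simp only [scaledMean]
  rw [integral_sub (hf.integrable_smul hZ x) (hg.integrable_smul hZ x), sub_div]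

theorem scaledMean_const_mul (c : ℝ) (x : ℝ) :
    scaledMean P Z G (fun v => c * f v) x = c * scaledMean P Z G f x := by
  simp only [scaledMean]
  rw [integral_const_mul, mul_div_assoc]

theorem scaledMean_sum {ι : Type*} (s : Finset ι) {F : ι → V → ℝ} (hF : ∀ i ∈ s, BddMeas (F i))
    (hZ : Measurable Z) (x : ℝ) :
    scaledMean P Z G (fun v => ∑ i ∈ s, F i v) x = ∑ i ∈ s, scaledMean P Z G (F i) x := by
  simp only [scaledMean]
  rw [integral_finsetSum _ (fun i hi => (hF i hi).integrable_smul hZ x), Finset.sum_div]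

theorem scaledMean_mono (hf : BddMeas f) (hg : BddMeas g) (hZ : Measurable Z) (hG : ∀ x, 0 ≤ G x)
    (hfg : ∀ v, f v ≤ g v) (x : ℝ) : scaledMean P Z G f x ≤ scaledMean P Z G g x := by
  simp only [scaledMean]
  exact div_le_div_of_nonneg_right (integral_mono (hf.integrable_smul hZ x)
    (hg.integrable_smul hZ x) fun ω => hfg _) (hG x)

theorem abs_scaledMean_sub_le (hf : BddMeas f) (hg : BddMeas g) (hh : BddMeas h)
    (hZ : Measurable Z) (hG : ∀ x, 0 ≤ G x) (hfg : ∀ v, |f v - g v| ≤ h v) (x : ℝ) :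
    |scaledMean P Z G f x - scaledMean P Z G g x| ≤ scaledMean P Z G h x := by
  rw [← scaledMean_sub hf hg hZ, abs_le]
  constructor
  · have := scaledMean_mono (P := P) (hh.const_mul (-1)) (hf.sub hg) hZ hG
      (fun v => by linarith [(abs_le.1 (hfg v)).1]) x
    rw [scaledMean_const_mul] at this
    linarith
  · exact scaledMean_mono (hf.sub hg) hh hZ hG (fun v => (abs_le.1 (hfg v)).2) x

/-- Convergence of normalised means is stable under approximation. -/
theorem exists_tendsto_scaledMean_of_approx (hZ : Measurable Z) (hG : ∀ x, 0 ≤ G x)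
    (hf : BddMeas f)
    (H : ∀ ε > 0, ∃ g h : V → ℝ, BddMeas g ∧ BddMeas h ∧ (∀ v, |f v - g v| ≤ h v) ∧
      (∃ l, Tendsto (scaledMean P Z G g) atTop (𝓝 l)) ∧
      ∀ᶠ x in atTop, scaledMean P Z G h x ≤ ε) :
    ∃ l, Tendsto (scaledMean P Z G f) atTop (𝓝 l) := by
  refine exists_tendsto_of_approx fun ε hε => ?_
  obtain ⟨g, h, hg, hh, hfg, hl, hε⟩ := H ε hε
  exact ⟨_, hl, hε.mono fun x hx => (abs_scaledMean_sub_le hf hg hh hZ hG hfg x).trans hx⟩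

/-- The mean of `f (c • Z / x)` is the mean of `f` at scale `c⁻¹ * x`; renormalising costs `G (c⁻¹ *
x) / G x`, which tends to `c ^ α`. -/
theorem scaledMean_comp_smul {α l c : ℝ} (hc : 0 < c) (hG : TailRV G α)
    (hl : Tendsto (scaledMean P Z G f) atTop (𝓝 l)) :
    Tendsto (scaledMean P Z G (fun v => f (c • v))) atTop (𝓝 (l * c ^ α)) := by
  have h1 : Tendsto (fun x => scaledMean P Z G f (c⁻¹ * x)) atTop (𝓝 l) :=
    hl.comp (tendsto_id.const_mul_atTop (inv_pos.2 hc))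
  have h2 := h1.mul (hG c⁻¹ (inv_pos.2 hc))
  rw [Real.rpow_neg (inv_pos.2 hc).le, Real.inv_rpow hc.le, inv_inv] at h2
  refine h2.congr' ?_
  filter_upwards [hG.eventually_ne_mul (inv_pos.2 hc)] with x hx
  simp only [scaledMean, mul_inv, inv_inv, smul_smul]
  rw [div_mul_div_cancel₀ hx]

/-- Normalised mean of the indicator of `{q > a}`. -/
theorem scaledMean_indicator_one {q : V → ℝ} (hq : Measurable q)
    (hhom : ∀ c : ℝ, 0 < c → ∀ v, q (c • v) = c * q v) (hZ : Measurable Z) (a : ℝ) {x : ℝ}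
    (hx : 0 < x) :
    scaledMean P Z G ({v | a < q v}.indicator fun _ => 1) x =
      upperTail P (fun ω => q (Z ω)) (a * x) / G x := by
  have : (fun ω => ({v | a < q v}.indicator (fun _ => (1 : ℝ))) (x⁻¹ • Z ω)) =
      {ω | a * x < q (Z ω)}.indicator 1 := by
    ext ω
    have : a < q (x⁻¹ • Z ω) ↔ a * x < q (Z ω) := by
      rw [hhom _ (inv_pos.2 hx), inv_mul_eq_div, lt_div_iff₀ hx]
    simp [Set.indicator_apply, this]
  have hm : MeasurableSet {ω | a * x < q (Z ω)} :=
    measurableSet_lt measurable_const (hq.comp hZ)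
  rw [scaledMean, this, integral_indicator_one hm, upperTail]

theorem BddMeas.indicator_gt {q : V → ℝ} (hq : Measurable q) (a : ℝ) :
    BddMeas ({v | a < q v}.indicator fun _ => (1 : ℝ)) :=
  (BddMeas.const 1).indicator (measurableSet_lt measurable_const hq)

end ScaledMean

/-! ### Discontinuous test functions -/

/-- The piecewise linear function that is `0` on `(-∞, a]` and `1` on `[b, ∞)`. -/
noncomputable def ramp (a b s : ℝ) : ℝ := max 0 (min 1 ((s - a) / (b - a)))

theorem ramp_nonneg (a b s : ℝ) : 0 ≤ ramp a b s := le_max_left _ _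

theorem ramp_le_one (a b s : ℝ) : ramp a b s ≤ 1 := max_le zero_le_one (min_le_left _ _)

theorem abs_ramp_le_one (a b s : ℝ) : |ramp a b s| ≤ 1 := by
  rw [abs_of_nonneg (ramp_nonneg a b s)]; exact ramp_le_one a b s

theorem ramp_of_le {a b s : ℝ} (hab : a < b) (hs : s ≤ a) : ramp a b s = 0 :=
  max_eq_left ((min_le_right _ _).trans
    (div_nonpos_of_nonpos_of_nonneg (by linarith) (by linarith)))

theorem ramp_of_ge {a b s : ℝ} (hab : a < b) (hs : b ≤ s) : ramp a b s = 1 := by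
  have : 1 ≤ (s - a) / (b - a) := by rw [le_div_iff₀ (by linarith)]; linarith
  rw [ramp, min_eq_left this, max_eq_right zero_le_one]

theorem ramp_mono {a b s t : ℝ} (hab : a < b) (h : s ≤ t) : ramp a b s ≤ ramp a b t := by
  have : (s - a) / (b - a) ≤ (t - a) / (b - a) :=
    div_le_div_of_nonneg_right (by linarith) (by linarith)
  exact max_le_max le_rfl (min_le_min le_rfl this)

theorem continuous_ramp (a b : ℝ) : Continuous (ramp a b) := by
  unfold ramp; fun_prop

theorem indicator_le_ramp {V : Type*} {a b : ℝ} (hab : a < b) (q : V → ℝ) (v : V) :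
    ({v | b < q v}.indicator (fun _ => (1 : ℝ))) v ≤ ramp a b (q v) := by
  by_cases h : b < q v
  · simp [h, ramp_of_ge hab h.le]
  · simp [h, ramp_nonneg]

theorem ramp_le_indicator {V : Type*} {a b : ℝ} (hab : a < b) (q : V → ℝ) (v : V) :
    ramp a b (q v) ≤ ({v | a < q v}.indicator (fun _ => (1 : ℝ))) v := by
  by_cases h : a < q v
  · simp [h, ramp_le_one]
  · simp [h, ramp_of_le hab (not_lt.1 h)]

section

variable {Ω V : Type*} [MeasurableSpace Ω] [NormedAddCommGroup V] [NormedSpace ℝ V]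
  [MeasurableSpace V] [BorelSpace V]
  {P : Measure Ω} [IsFiniteMeasure P] {Z : Ω → V} {G : ℝ → ℝ} {f : V → ℝ} {q : V → ℝ} {α : ℝ}

/-- The ramp starts at `a > 0` and homogeneity forces `q 0 = 0`, so the product vanishes near the
origin and is an admissible test function. -/
theorem HasTailLimits.mul_ramp (hT : HasTailLimits P Z G) (hq : Continuous q)
    (hhom : ∀ c : ℝ, 0 < c → ∀ v, q (c • v) = c * q v) (hf : Continuous f)
    (hC : ∃ C, ∀ v, |f v| ≤ C) {a b : ℝ} (ha : 0 < a) (hab : a < b) :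
    ∃ l, Tendsto (scaledMean P Z G (fun v => f v * ramp a b (q v))) atTop (𝓝 l) := by
  refine hT _ (hf.mul ((continuous_ramp a b).comp hq)) ?_ ?_
  · obtain ⟨C, hC⟩ := hC
    refine ⟨C, fun v => ?_⟩
    rw [abs_mul]
    exact (mul_le_of_le_one_right (abs_nonneg _) (abs_ramp_le_one _ _ _)).trans (hC v)
  · have h0 : q 0 = 0 := by
      have := hhom 2 two_pos 0
      rw [smul_zero] at this
      linarith
    have : ∀ᶠ v in 𝓝 (0 : V), q v < a := hq.continuousAt.eventually_lt_const (by rwa [h0])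
    obtain ⟨δ, hδ, h⟩ := Metric.eventually_nhds_iff.1 this
    refine ⟨δ, hδ, fun v hv => ?_⟩
    rw [ramp_of_le hab (h (by rwa [dist_zero_right])).le, mul_zero]

theorem bddMeas_ramp (hq : Measurable q) (a b : ℝ) : BddMeas (fun v => ramp a b (q v)) :=
  ⟨(continuous_ramp a b).measurable.comp hq, 1, fun _ => abs_ramp_le_one _ _ _⟩

/-- Convergence of the normalised means of `f · 1{q > 1}` for bounded continuous `f`. -/
theorem HasTailLimits.indicator (hT : HasTailLimits P Z G) (hα : 0 < α) (hRV : TailRV G α)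
    (hG : ∀ x, 0 ≤ G x) (hZ : Measurable Z) (hq : Continuous q) (hq0 : ∀ v, 0 ≤ q v)
    (hhom : ∀ c : ℝ, 0 < c → ∀ v, q (c • v) = c * q v) (hf : Continuous f)
    (hC : ∃ C, ∀ v, |f v| ≤ C) :
    ∃ l, Tendsto (scaledMean P Z G ({v | 1 < q v}.indicator f)) atTop (𝓝 l) := by
  have hfB : BddMeas f := BddMeas.of_continuous hf hC
  obtain ⟨C, hC⟩ := hC
  have hC0 : 0 ≤ C := (abs_nonneg _).trans (hC 0)
  have hone : ∀ {a b : ℝ}, 0 < a → a < b →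
      ∃ l, Tendsto (scaledMean P Z G (fun v => ramp a b (q v))) atTop (𝓝 l) := by
    intro a b ha hab
    simpa using hT.mul_ramp hq hhom (f := fun _ => 1) continuous_const ⟨1, by simp⟩ ha hab
  -- `L` bounds the limits of all the ramps from `1` to `1 + δ`, so `δ` can be chosen before the
  -- limit `l` belonging to it.
  obtain ⟨L, hL⟩ := hone (a := 1 / 2) (b := 1) (by norm_num) (by norm_num)
  refine exists_tendsto_scaledMean_of_approx hZ hG
    (hfB.indicator (measurableSet_lt measurable_const hq.measurable)) fun ε hε => ?_
  obtain ⟨δ, hδ, hδε⟩ : ∃ δ : ℝ, 0 < δ ∧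
      C * (L * ((1 + δ) ^ α - ((1 + δ)⁻¹) ^ α)) < ε := by
    have h1 : ContinuousAt (fun δ : ℝ => C * (L * ((1 + δ) ^ α - ((1 + δ)⁻¹) ^ α))) 0 := by
      have : ContinuousAt (fun δ : ℝ => 1 + δ) 0 := by fun_prop
      refine continuousAt_const.mul (continuousAt_const.mul (ContinuousAt.sub ?_ ?_))
      · exact this.rpow_const (Or.inl (by norm_num))
      · exact (this.inv₀ (by norm_num)).rpow_const (Or.inl (by norm_num))
    have h2 := h1.eventually_lt_const (u := ε) (by simpa using hε)
    obtain ⟨δ, h3, h4⟩ := ((h2.filter_mono (nhdsWithin_le_nhds (s := Set.Ioi 0))).and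
      self_mem_nhdsWithin).exists
    exact ⟨δ, h4, h3⟩
  obtain ⟨l, hl⟩ := hone (a := 1) (b := 1 + δ) one_pos (by linarith)
  have hρ : BddMeas (fun v => ramp 1 (1 + δ) (q v)) := bddMeas_ramp hq.measurable _ _
  have hρc : ∀ c : ℝ, BddMeas (fun v => ramp 1 (1 + δ) (q (c • v))) := fun c =>
    hρ.comp (measurable_id.const_smul c)
  have hlL : l ≤ L := by
    refine le_of_tendsto_of_tendsto' hl hL fun x => ?_
    refine scaledMean_mono hρ (bddMeas_ramp hq.measurable _ _) hZ hG (fun v => ?_) x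
    exact (ramp_le_indicator (by linarith) q v).trans (indicator_le_ramp (by norm_num) q v)
  have hd : 0 < 1 + δ := by linarith
  have hlim := (scaledMean_comp_smul hd hRV hl).sub
    (scaledMean_comp_smul (inv_pos.2 hd) hRV hl)
  rw [← mul_sub] at hlim
  have hlim := hlim.const_mul C
  have hpow : 0 ≤ (1 + δ) ^ α - ((1 + δ)⁻¹) ^ α :=
    sub_nonneg.2 (Real.rpow_le_rpow (inv_pos.2 hd).le
      ((inv_le_one_of_one_le₀ (by linarith)).trans (by linarith)) hα.le)
  -- The error bound is `C` times the difference of the same ramp dilated by `1 + δ` and by its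
  -- inverse. It equals `C` on the shell `1 < q < 1 + δ`, and its mean has a limit by
  -- `scaledMean_comp_smul`.
  refine ⟨fun v => f v * ramp 1 (1 + δ) (q v),
    fun v => C * (ramp 1 (1 + δ) (q ((1 + δ) • v)) - ramp 1 (1 + δ) (q ((1 + δ)⁻¹ • v))),
    ?_, ((hρc _).sub (hρc _)).const_mul C, fun v => ?_,
    hT.mul_ramp hq hhom hf ⟨C, hC⟩ one_pos (by linarith), ?_⟩
  · exact BddMeas.of_continuous (hf.mul ((continuous_ramp _ _).comp hq)) ⟨C, fun v => by
      rw [abs_mul]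
      exact (mul_le_of_le_one_right (abs_nonneg _) (abs_ramp_le_one _ _ _)).trans (hC v)⟩
  · beta_reduce
    have hle : q ((1 + δ)⁻¹ • v) ≤ q ((1 + δ) • v) := by
      rw [hhom _ hd, hhom _ (inv_pos.2 hd)]
      refine mul_le_mul_of_nonneg_right ?_ (hq0 v)
      exact (inv_le_one_of_one_le₀ (by linarith)).trans (by linarith)
    have hnn : 0 ≤ C * (ramp 1 (1 + δ) (q ((1 + δ) • v)) -
        ramp 1 (1 + δ) (q ((1 + δ)⁻¹ • v))) :=
      mul_nonneg hC0 (sub_nonneg.2 (ramp_mono (by linarith) hle))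
    by_cases h1 : 1 < q v
    · by_cases h2 : 1 + δ ≤ q v
      · rw [ramp_of_ge (by linarith) h2]
        simpa [h1] using hnn
      · have e1 : ramp 1 (1 + δ) (q ((1 + δ) • v)) = 1 := by
          refine ramp_of_ge (by linarith) ?_
          rw [hhom _ hd]
          nlinarith
        have e2 : ramp 1 (1 + δ) (q ((1 + δ)⁻¹ • v)) = 0 := by
          refine ramp_of_le (by linarith) ?_
          rw [hhom _ (inv_pos.2 hd), inv_mul_le_iff₀ hd]
          linarith
        rw [e1, e2, sub_zero, mul_one]
        have : ({v | 1 < q v}.indicator f) v = f v := by simp [h1]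
        rw [this, ← mul_one_sub, abs_mul]
        refine (mul_le_of_le_one_right (abs_nonneg _) ?_).trans (hC v)
        rw [abs_le]
        constructor <;> linarith [ramp_nonneg 1 (1 + δ) (q v), ramp_le_one 1 (1 + δ) (q v)]
    · rw [ramp_of_le (by linarith) (not_lt.1 h1)]
      simpa [h1] using hnn
  · have hlt : C * (l * ((1 + δ) ^ α - ((1 + δ)⁻¹) ^ α)) < ε :=
      (mul_le_mul_of_nonneg_left (mul_le_mul_of_nonneg_right hlL hpow) hC0).trans_lt hδε
    filter_upwards [hlim.eventually_lt_const hlt] with x hx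
    rw [scaledMean_const_mul, scaledMean_sub (hρc _) (hρc _) hZ]
    exact hx.le

/-- Used to compare normalisers. The limit may be `0`; positivity needs a separate argument at each
use. -/
theorem HasTailLimits.upperTail_ratio (hT : HasTailLimits P Z G) (hα : 0 < α) (hRV : TailRV G α)
    (hG : ∀ x, 0 ≤ G x) (hZ : Measurable Z) (hq : Continuous q) (hq0 : ∀ v, 0 ≤ q v)
    (hhom : ∀ c : ℝ, 0 < c → ∀ v, q (c • v) = c * q v) :
    ∃ l, Tendsto (fun x => upperTail P (fun ω => q (Z ω)) x / G x) atTop (𝓝 l) := by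
  obtain ⟨l, hl⟩ := hT.indicator hα hRV hG hZ hq hq0 hhom (f := fun _ => 1) continuous_const
    ⟨1, by simp⟩
  refine ⟨l, hl.congr' ?_⟩
  filter_upwards [eventually_gt_atTop 0] with x hx
  rw [scaledMean_indicator_one hq.measurable hhom hZ 1 hx, one_mul]

end

/-! ### Regularly varying vectors have tail limits -/

section

variable {Ω V : Type*} [MeasurableSpace Ω] [NormedAddCommGroup V] [NormedSpace ℝ V]
  [FiniteDimensional ℝ V] [MeasurableSpace V] [BorelSpace V]
  {P : Measure Ω} {Z : Ω → V} {G : ℝ → ℝ} {f : V → ℝ} {α : ℝ}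

theorem eventually_scaledMean_norm_le [IsFiniteMeasure P] (hZ : Measurable Z)
    (hG : ∀ x, 0 ≤ G x) (hRV : TailRV G α) {K c : ℝ} (hc : 0 < c)
    (hdom : ∀ x, upperTail P (fun ω => ‖Z ω‖) x ≤ K * G (c * x)) {a B : ℝ} (ha : 0 < a)
    (hB : K * (c * a) ^ (-α) < B) :
    ∀ᶠ x in atTop, scaledMean P Z G ({v | a < ‖v‖}.indicator fun _ => 1) x ≤ B := by
  filter_upwards [((hRV (c * a) (by positivity)).const_mul K).eventually_lt_const hB,
    eventually_gt_atTop 0] with x hx hx0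
  rw [scaledMean_indicator_one measurable_norm
    (fun c hc v => by rw [norm_smul, Real.norm_of_nonneg hc.le]) hZ a hx0]
  refine le_trans (div_le_div_of_nonneg_right (hdom _) (hG x)) ?_
  rw [mul_div_assoc, ← mul_assoc]
  exact hx.le

/-- To obtain tail limits it suffices to consider compactly supported test functions. -/
theorem HasTailLimits.of_hasCompactSupport [IsFiniteMeasure P] (hα : 0 < α) (hZ : Measurable Z)
    (hG : ∀ x, 0 ≤ G x) (hRV : TailRV G α) {K c : ℝ} (hc : 0 < c)
    (hdom : ∀ x, upperTail P (fun ω => ‖Z ω‖) x ≤ K * G (c * x))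
    (H : ∀ f : V → ℝ, Continuous f → HasCompactSupport f → (∃ δ > 0, ∀ v, ‖v‖ < δ → f v = 0) →
      ∃ l, Tendsto (scaledMean P Z G f) atTop (𝓝 l)) : HasTailLimits P Z G := by
  intro f hf hC hδ
  have hfB : BddMeas f := BddMeas.of_continuous hf hC
  obtain ⟨C, hC⟩ := hC
  obtain ⟨δ, hδ, hδ0⟩ := hδ
  have hC0 : 0 ≤ C := (abs_nonneg _).trans (hC 0)
  refine exists_tendsto_scaledMean_of_approx hZ hG hfB fun ε hε => ?_
  -- The cutoff radius is taken so large that the limiting bound on the mass beyond it, times `C`,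
  -- is below `ε`.
  obtain ⟨M₀, hM₀, hM⟩ := exists_mul_rpow_neg_le hα (K := C * K) hε
  obtain ⟨M, hM0, hM⟩ : ∃ M, 0 < M ∧ C * K * (c * M) ^ (-α) < ε :=
    ⟨M₀ / c, by positivity, by rw [mul_div_cancel₀ _ hc.ne']; exact hM _ le_rfl⟩
  have hcont : Continuous fun v => f v * (1 - ramp M (M + 1) ‖v‖) :=
    hf.mul (continuous_const.sub ((continuous_ramp _ _).comp continuous_norm))
  have hle : ∀ v : V, |1 - ramp M (M + 1) ‖v‖| ≤ 1 := fun v => by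
    rw [abs_le]
    constructor <;> linarith [ramp_nonneg M (M + 1) ‖v‖, ramp_le_one M (M + 1) ‖v‖]
  refine ⟨fun v => f v * (1 - ramp M (M + 1) ‖v‖),
    fun v => C * ({v : V | M < ‖v‖}.indicator fun _ => 1) v,
    BddMeas.of_continuous hcont ⟨C, fun v => ?_⟩,
    (BddMeas.indicator_gt measurable_norm M).const_mul C, fun v => ?_,
    H _ hcont ?_ ⟨δ, hδ, fun v hv => by rw [hδ0 v hv, zero_mul]⟩, ?_⟩
  · rw [abs_mul]
    exact (mul_le_of_le_one_right (abs_nonneg _) (hle v)).trans (hC v)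
  · have : f v - f v * (1 - ramp M (M + 1) ‖v‖) = f v * ramp M (M + 1) ‖v‖ := by ring
    rw [this, abs_mul, abs_of_nonneg (ramp_nonneg _ _ _)]
    exact mul_le_mul (hC v) (ramp_le_indicator (by linarith) (fun v : V => ‖v‖) v)
      (ramp_nonneg _ _ _) hC0
  · refine HasCompactSupport.of_support_subset_isCompact (isCompact_closedBall 0 (M + 1))
      fun v hv => ?_
    by_contra hn
    rw [mem_closedBall_zero_iff, not_le] at hn
    exact hv (by simp only; rw [ramp_of_ge (by linarith) hn.le, sub_self, mul_zero])
  · by_cases hC' : C = 0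
    · refine Eventually.of_forall fun x => ?_
      simp [scaledMean, hC', hε.le]
    · have hC'' : 0 < C := lt_of_le_of_ne hC0 (Ne.symm hC')
      have : K * (c * M) ^ (-α) < ε / C := by
        rw [lt_div_iff₀ hC'']
        linarith
      filter_upwards [eventually_scaledMean_norm_le hZ hG hRV hc hdom hM0 this] with x hx
      rw [scaledMean_const_mul]
      rw [le_div_iff₀ hC''] at hx
      linarith

theorem integral_finiteLaw {W : Type*} [MeasurableSpace W] [IsFiniteMeasure P] {Z : Ω → W}
    (hZ : Measurable Z) {f : W → ℝ} (hf : Measurable f) :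
    ∫ v, f v ∂(finiteLaw P Z : Measure W) = ∫ ω, f (Z ω) ∂P :=
  integral_map hZ.aemeasurable hf.aestronglyMeasurable

/-- The function `v ↦ 1{u < p v} g (v / p v)`. -/
noncomputable def polarFun (p : Seminorm ℝ V) (u : ℝ) (g : V → ℝ) : V → ℝ :=
  {v | u < p v}.indicator fun v => g ((p v)⁻¹ • v)

theorem measurable_normalize (p : Seminorm ℝ V) : Measurable fun v : V => (p v)⁻¹ • v :=
  (p.continuous_of_finiteDimensional.measurable.inv).smul measurable_id

theorem bddMeas_polarFun (p : Seminorm ℝ V) (u : ℝ) {g : V → ℝ} (hg : BddMeas g) :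
    BddMeas (polarFun p u g) :=
  (hg.comp (measurable_normalize p)).indicator
    (measurableSet_lt measurable_const p.continuous_of_finiteDimensional.measurable)

theorem Seminorm.smul_pos (p : Seminorm ℝ V) (c : ℝ) (hc : 0 < c) (v : V) :
    p (c • v) = c * p v := by
  rw [map_smul_eq_mul, Real.norm_of_nonneg hc.le]

theorem Seminorm.measurableSet_lt_comp (p : Seminorm ℝ V) (hZ : Measurable Z) (a : ℝ) :
    MeasurableSet {ω | a < p (Z ω)} :=
  measurableSet_lt measurable_const (p.continuous_of_finiteDimensional.measurable.comp hZ)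

theorem scaledMean_polarFun (hZ : Measurable Z) (p : Seminorm ℝ V) (u : ℝ) (g : V → ℝ) {x : ℝ}
    (hx : 0 < x) :
    scaledMean P Z G (polarFun p u g) x =
      (∫ ω in {ω | u * x < p (Z ω)}, g ((p (Z ω))⁻¹ • Z ω) ∂P) / G x := by
  rw [scaledMean, ← integral_indicator (p.measurableSet_lt_comp hZ _)]
  congr 2
  ext ω
  have h1 : p (x⁻¹ • Z ω) = x⁻¹ * p (Z ω) := p.smul_pos _ (inv_pos.2 hx) _
  have h2 : u < p (x⁻¹ • Z ω) ↔ u * x < p (Z ω) := by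
    rw [h1, inv_mul_eq_div, lt_div_iff₀ hx]
  have h3 : (p (x⁻¹ • Z ω))⁻¹ • x⁻¹ • Z ω = (p (Z ω))⁻¹ • Z ω := by
    rw [h1, smul_smul]
    congr 1
    field_simp
  simp only [polarFun, Set.indicator_apply, Set.mem_ofPred_eq, h2, h3]

/-- Weak convergence in the definition of regular variation in terms of integrals. -/
theorem tendsto_restrict_finiteLaw_iff [IsProbabilityMeasure P] (hZ : Measurable Z)
    (p : Seminorm ℝ V) (σ : ProbabilityMeasure V) {u : ℝ} (hu : 0 < u) :
    Tendsto (fun x : ℝ => (P {ω | x < p (Z ω)}).toNNReal⁻¹ •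
        finiteLaw (P.restrict {ω | u * x < p (Z ω)}) (fun ω => (p (Z ω))⁻¹ • Z ω))
      atTop (𝓝 ((u ^ (-α)).toNNReal • σ.toFiniteMeasure)) ↔
    ∀ g : BoundedContinuousFunction V ℝ,
      Tendsto (scaledMean P Z (upperTail P fun ω => p (Z ω)) (polarFun p u g)) atTop
        (𝓝 (u ^ (-α) * ∫ v, g v ∂(σ : Measure V))) := by
  rw [FiniteMeasure.tendsto_iff_forall_integral_tendsto]
  refine forall_congr' fun g => ?_
  have h1 : ∫ v, g v ∂(((u ^ (-α)).toNNReal • σ.toFiniteMeasure : FiniteMeasure V) : Measure V) =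
      u ^ (-α) * ∫ v, g v ∂(σ : Measure V) := by
    rw [FiniteMeasure.toMeasure_smul, integral_smul_nnreal_measure, NNReal.smul_def,
      Real.coe_toNNReal _ (Real.rpow_nonneg hu.le _), smul_eq_mul]
    rfl
  rw [h1]
  refine tendsto_congr' ?_
  filter_upwards [eventually_gt_atTop 0] with x hx
  have hm : Measurable fun ω => (p (Z ω))⁻¹ • Z ω := (measurable_normalize p).comp hZ
  rw [FiniteMeasure.toMeasure_smul, integral_smul_nnreal_measure, NNReal.smul_def,
    integral_finiteLaw hm g.continuous.measurable, scaledMean_polarFun hZ p u g hx, smul_eq_mul,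
    div_eq_inv_mul]
  rfl

theorem tailRV_of_polar [IsProbabilityMeasure P] (hZ : Measurable Z)
    (p : Seminorm ℝ V) (σ : ProbabilityMeasure V)
    (h : ∀ u : ℝ, 0 < u → ∀ g : BoundedContinuousFunction V ℝ,
      Tendsto (scaledMean P Z (upperTail P fun ω => p (Z ω)) (polarFun p u g)) atTop
        (𝓝 (u ^ (-α) * ∫ v, g v ∂(σ : Measure V)))) :
    TailRV (upperTail P fun ω => p (Z ω)) α := by
  intro u hu
  have := h u hu (BoundedContinuousFunction.const V 1)
  simp only [BoundedContinuousFunction.const_apply, integral_const, probReal_univ, smul_eq_mul,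
    mul_one] at this
  refine this.congr' ?_
  filter_upwards [eventually_gt_atTop 0] with x hx
  rw [scaledMean_polarFun hZ p u _ hx]
  simp [upperTail]

/-- Approximation of a function by a step function in the radial direction. -/
theorem abs_sub_sum_polarFun_le {p : Seminorm ℝ V} {f : V → ℝ} {a b c r ε η : ℝ} (hc : 0 < c)
    (hp : ∀ v, c * ‖v‖ ≤ p v) (ha : 0 < a) (hfa : ∀ v, p v < a → f v = 0)
    (hfb : ∀ v, b < p v → f v = 0) (hη : 0 ≤ η)
    (hunif : ∀ v w, ‖v - w‖ < ε → |f v - f w| ≤ η) (hr : 0 < r) (hrε : r < c * ε) {n : ℕ}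
    (hn : b ≤ n * r) (v : V) :
    |f v - ∑ j ∈ Finset.range n, (polarFun p (j * r) (fun θ => f ((j * r : ℝ) • θ)) v -
      polarFun p ((j + 1) * r) (fun θ => f ((j * r : ℝ) • θ)) v)| ≤
      η * ({v | a / 2 < p v}.indicator fun _ => 1) v := by
  have hrhs : 0 ≤ η * ({v | a / 2 < p v}.indicator (fun _ => (1 : ℝ))) v :=
    mul_nonneg hη (Set.indicator_nonneg (fun _ _ => zero_le_one) _)
  -- The `j`-th summand lives on the `j`-th shell; the shells are disjoint, so at most one summand
  -- is nonzero at `v`.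
  have hterm : ∀ j : ℕ, ¬ (j * r < p v ∧ p v ≤ (j + 1) * r) →
      (polarFun p (j * r) (fun θ => f ((j * r : ℝ) • θ)) v -
      polarFun p ((j + 1) * r) (fun θ => f ((j * r : ℝ) • θ)) v) = 0 := by
    intro j hj
    simp only [polarFun, Set.indicator_apply, Set.mem_ofPred_eq]
    by_cases h1 : j * r < p v
    · have h2 : (j + 1) * r < p v := by
        by_contra h2
        exact hj ⟨h1, not_lt.1 h2⟩
      simp [h1, h2]
    · have h2 : ¬ (j + 1) * r < p v := by
        intro h2
        exact h1 (by nlinarith)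
      simp [h1, h2]
  by_cases hex : 0 < p v ∧ p v ≤ n * r
  · obtain ⟨h0, h1⟩ := hex
    obtain ⟨j, hj⟩ : ∃ j : ℕ, ⌈p v / r⌉₊ = j + 1 :=
      Nat.exists_eq_succ_of_ne_zero (Nat.ceil_pos.2 (by positivity)).ne'
    have hup : p v ≤ (j + 1) * r := by
      have := Nat.le_ceil (p v / r)
      rw [hj, div_le_iff₀ hr] at this
      exact_mod_cast this
    have hlo : j * r < p v := by
      have : j < ⌈p v / r⌉₊ := by omega
      rwa [Nat.lt_ceil, lt_div_iff₀ hr] at this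
    have hjn : j < n := by
      have : j * r < n * r := hlo.trans_le h1
      exact_mod_cast lt_of_mul_lt_mul_right this hr.le
    rw [Finset.sum_eq_single_of_mem j (Finset.mem_range.2 hjn)]
    · have e1 : polarFun p (j * r) (fun θ => f ((j * r : ℝ) • θ)) v =
          f ((j * r : ℝ) • (p v)⁻¹ • v) := by simp [polarFun, hlo]
      have e2 : polarFun p ((j + 1) * r) (fun θ => f ((j * r : ℝ) • θ)) v = 0 := by
        simp [polarFun, hup]
      rw [e1, e2, sub_zero]
      by_cases hav : a / 2 < p v
      · simp only [Set.indicator_apply, Set.mem_ofPred_eq, hav, if_true, mul_one]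
        refine hunif _ _ ?_
        -- Moving `v` radially to the inner boundary of its shell displaces it by at most `r / c <
        -- ε`.
        have : v - (j * r : ℝ) • (p v)⁻¹ • v = ((p v - j * r) * (p v)⁻¹) • v := by
          rw [smul_smul, sub_mul, mul_inv_cancel₀ h0.ne', sub_smul, one_smul]
        rw [this, norm_smul, Real.norm_of_nonneg (mul_nonneg (by linarith) (by positivity)),
          mul_assoc, inv_mul_eq_div]
        have hvp : ‖v‖ / p v ≤ 1 / c := by
          rw [div_le_div_iff₀ h0 hc]
          linarith [hp v]
        calc (p v - j * r) * (‖v‖ / p v) ≤ r * (1 / c) :=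
              mul_le_mul (by linarith) hvp (by positivity) hr.le
          _ < ε := by rw [mul_one_div, div_lt_iff₀ hc]; linarith
      · rw [hfa v (by linarith), hfa]
        · simpa using hrhs
        · rw [map_smul_eq_mul, map_smul_eq_mul, Real.norm_of_nonneg (by positivity),
            Real.norm_of_nonneg (by positivity), inv_mul_cancel₀ h0.ne', mul_one]
          linarith
    · intro i _ hij
      refine hterm i fun ⟨h2, h3⟩ => hij ?_
      have a1 : (i : ℝ) * r < (j + 1) * r := h2.trans_le hup
      have a2 : (j : ℝ) * r < (i + 1) * r := hlo.trans_le h3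
      have a1 : (i : ℝ) < j + 1 := lt_of_mul_lt_mul_right a1 hr.le
      have a2 : (j : ℝ) < i + 1 := lt_of_mul_lt_mul_right a2 hr.le
      norm_cast at a1 a2
      omega
  · rw [Finset.sum_eq_zero]
    · have : f v = 0 := by
        by_cases h : b < p v
        · exact hfb v h
        · refine hfa v ?_
          have : ¬ 0 < p v := fun h0 => hex ⟨h0, (not_lt.1 h).trans hn⟩
          linarith
      simpa [this] using hrhs
    · intro j hjn
      refine hterm j fun ⟨h2, h3⟩ => hex ⟨?_, h3.trans ?_⟩
      · exact lt_of_le_of_lt (by positivity) h2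
      · have : (j : ℝ) + 1 ≤ n := by exact_mod_cast Finset.mem_range.1 hjn
        exact mul_le_mul_of_nonneg_right this hr.le

/-- Uniform continuity makes `f` nearly constant along rays within a shell. The resulting finite sum
of `polarFun` differences has convergent means, and the error is `η` times a mass bounded in the
limit. -/
theorem HasTailLimits.of_polar [IsProbabilityMeasure P] (hα : 0 < α) (hZ : Measurable Z)
    {p : Seminorm ℝ V} (hp : IsNorm p) (σ : ProbabilityMeasure V)
    (h : ∀ u : ℝ, 0 < u → ∀ g : BoundedContinuousFunction V ℝ,
      Tendsto (scaledMean P Z (upperTail P fun ω => p (Z ω)) (polarFun p u g)) atTop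
        (𝓝 (u ^ (-α) * ∫ v, g v ∂(σ : Measure V)))) :
    HasTailLimits P Z (upperTail P fun ω => p (Z ω)) := by
  have hRV := tailRV_of_polar hZ p σ h
  have hG := upperTail_nonneg P fun ω => p (Z ω)
  obtain ⟨c, hc, hpc⟩ := hp.exists_mul_norm_le
  obtain ⟨C, hC, hpC⟩ := p.exists_le_mul_norm
  refine HasTailLimits.of_hasCompactSupport hα hZ hG hRV (K := 1) hc (fun x => ?_) ?_
  · rw [one_mul]
    refine measureReal_mono fun ω (hω : x < ‖Z ω‖) => ?_
    exact (mul_lt_mul_of_pos_left hω hc).trans_le (hpc _)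
  intro f hf hfs ⟨δ, hδ, hδ0⟩
  obtain ⟨D, hD⟩ := hfs.exists_bound_of_continuous hf
  have hfB : BddMeas f := BddMeas.of_continuous hf ⟨D, hD⟩
  refine exists_tendsto_scaledMean_of_approx hZ hG hfB fun ε hε => ?_
  have hfa : ∀ v, p v < c * δ → f v = 0 := fun v hv =>
    hδ0 v (lt_of_mul_lt_mul_left ((hpc v).trans_lt hv) hc.le)
  obtain ⟨R, hR⟩ := hfs.isCompact.isBounded.subset_closedBall 0
  have hfb : ∀ v, C * R < p v → f v = 0 := by
    intro v hv
    by_contra hne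
    have := hR (subset_tsupport f hne)
    rw [mem_closedBall_zero_iff] at this
    have := mul_le_mul_of_nonneg_left this hC.le
    linarith [hpC v]
  have ha : 0 < c * δ := by positivity
  have hpow : 0 < (c * δ / 2) ^ (-α) := Real.rpow_pos_of_pos (by positivity) _
  -- The denominator exceeds the limiting mass of `{c * δ / 2 < p}` by `1`, hence bounds the mass
  -- for all large `x`.
  set η := ε / ((c * δ / 2) ^ (-α) + 1) with hη
  have hη0 : 0 < η := by positivity
  obtain ⟨ρ, hρ, hunif⟩ := Metric.uniformContinuous_iff.1
    (hfs.uniformContinuous_of_continuous hf) η hη0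
  set r := c * ρ / 2 with hr
  have hr0 : 0 < r := by positivity
  obtain ⟨n, hn⟩ := exists_nat_ge (C * R / r)
  rw [div_le_iff₀ hr0] at hn
  have hgB : ∀ j : ℕ, BddMeas fun θ => f ((j * r : ℝ) • θ) := fun j =>
    hfB.comp (measurable_id.const_smul _)
  have hDB : ∀ j : ℕ, BddMeas fun v => polarFun p (j * r) (fun θ => f ((j * r : ℝ) • θ)) v -
      polarFun p ((j + 1) * r) (fun θ => f ((j * r : ℝ) • θ)) v := fun j =>
    (bddMeas_polarFun p _ (hgB j)).sub (bddMeas_polarFun p _ (hgB j))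
  have hsumB : ∀ s : Finset ℕ, BddMeas fun v => ∑ j ∈ s,
      (polarFun p (j * r) (fun θ => f ((j * r : ℝ) • θ)) v -
      polarFun p ((j + 1) * r) (fun θ => f ((j * r : ℝ) • θ)) v) := by
    intro s
    induction s using Finset.induction_on with
    | empty => simpa using BddMeas.const (0 : ℝ)
    | insert j s hj ih =>
      simp only [Finset.sum_insert hj]
      exact (hDB j).add ih
  have hp_meas : Measurable p := p.continuous_of_finiteDimensional.measurable
  refine ⟨_, _, hsumB (Finset.range n), (BddMeas.indicator_gt hp_meas (c * δ / 2)).const_mul η,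
    abs_sub_sum_polarFun_le hc hpc ha hfa hfb hη0.le
      (fun v w hvw => (hunif (by rwa [dist_eq_norm])).le) hr0
      (by rw [hr]; nlinarith [mul_pos hc hρ]) hn, ?_, ?_⟩
  · have hterm : ∀ j : ℕ, ∃ l, Tendsto (scaledMean P Z (upperTail P fun ω => p (Z ω)) fun v =>
        polarFun p (j * r) (fun θ => f ((j * r : ℝ) • θ)) v -
        polarFun p ((j + 1) * r) (fun θ => f ((j * r : ℝ) • θ)) v) atTop (𝓝 l) := by
      intro j
      -- The innermost shell would need `h` at `u = 0`, which is not available; its summand vanishes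
      -- because `f 0 = 0`.
      rcases Nat.eq_zero_or_pos j with rfl | hj
      · have h0 : f 0 = 0 := hδ0 0 (by simpa using hδ)
        refine ⟨0, tendsto_const_nhds.congr fun x => ?_⟩
        simp [scaledMean, polarFun, h0]
      · have hj' : (0 : ℝ) < j := by exact_mod_cast hj
        let g : BoundedContinuousFunction V ℝ :=
          BoundedContinuousFunction.ofNormedAddCommGroup (fun θ => f ((j * r : ℝ) • θ))
            (hf.comp (continuous_const_smul _)) D fun θ => hD _
        refine ⟨_, ((h (j * r) (by positivity) g).sub
          (h ((j + 1) * r) (by positivity) g)).congr fun x => ?_⟩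
        exact (scaledMean_sub (bddMeas_polarFun p _ (hgB j)) (bddMeas_polarFun p _ (hgB j))
          hZ x).symm
    choose l hl using hterm
    refine ⟨_, (tendsto_finsetSum (Finset.range n) fun j _ => hl j).congr fun x => ?_⟩
    exact (scaledMean_sum _ (fun j _ => hDB j) hZ x).symm
  · filter_upwards [(hRV (c * δ / 2) (by positivity)).eventually_lt_const (lt_add_one _),
      eventually_gt_atTop 0] with x hx hx0
    rw [scaledMean_const_mul, scaledMean_indicator_one hp_meas p.smul_pos hZ _ hx0]
    calc _ ≤ η * ((c * δ / 2) ^ (-α) + 1) := mul_le_mul_of_nonneg_left hx.le hη0.le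
      _ = ε := by rw [hη]; field_simp

end

/-! ### Stationary processes -/

section

variable {Ω : Type*} [MeasurableSpace Ω] {P : Measure Ω} {d : ℕ}
  {ν : Seminorm ℝ (Fin d → ℝ)} {X : ℤ → Ω → (Fin d → ℝ)} {α : ℝ}

theorem IsStrictlyStationary.integral_shift (hstat : IsStrictlyStationary P X)
    (hX : ∀ t, Measurable (X t)) (h : ℤ) {F : (ℤ → Fin d → ℝ) → ℝ} (hF : Measurable F) :
    ∫ ω, F (fun t => X (t + h) ω) ∂P = ∫ ω, F (fun t => X t ω) ∂P := by
  have h1 : Measurable fun ω (t : ℤ) => X (t + h) ω := measurable_pi_lambda _ fun t => hX _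
  have h2 : Measurable fun ω (t : ℤ) => X t ω := measurable_pi_lambda _ fun t => hX _
  rw [← integral_map (f := F) h1.aemeasurable hF.aestronglyMeasurable, hstat h,
    integral_map h2.aemeasurable hF.aestronglyMeasurable]

theorem IsStrictlyStationary.upperTail_eq (hstat : IsStrictlyStationary P X)
    (hX : ∀ t, Measurable (X t)) (ν : Seminorm ℝ (Fin d → ℝ)) (t : ℤ) :
    upperTail P (fun ω => ν (X t ω)) = upperTail P (fun ω => ν (X 0 ω)) := by
  funext x
  have h1 : Measurable fun ω (s : ℤ) => X (s + t) ω := measurable_pi_lambda _ fun t => hX _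
  have h2 : Measurable fun ω (s : ℤ) => X s ω := measurable_pi_lambda _ fun t => hX _
  have hm : MeasurableSet {y : ℤ → Fin d → ℝ | x < ν (y 0)} :=
    measurableSet_lt measurable_const
      (ν.continuous_of_finiteDimensional.measurable.comp (measurable_pi_apply 0))
  have := congrArg (fun μ => μ {y : ℤ → Fin d → ℝ | x < ν (y 0)}) (hstat t)
  simp only [Measure.map_apply h1 hm, Measure.map_apply h2 hm] at this
  have h3 : P {ω | x < ν (X (0 + t) ω)} = P {ω | x < ν (X 0 ω)} := this
  rw [zero_add] at h3
  simp only [upperTail, Measure.real, h3]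

theorem IsStrictlyStationary.scaledMean_shift {ι : Type*} [Fintype ι]
    (hstat : IsStrictlyStationary P X) (hX : ∀ t, Measurable (X t)) (h : ℤ) (τ : ι → ℤ)
    (G : ℝ → ℝ) {f : (ι → Fin d → ℝ) → ℝ} (hf : Measurable f) (x : ℝ) :
    scaledMean P (fun ω i => X (τ i + h) ω) G f x = scaledMean P (fun ω i => X (τ i) ω) G f x := by
  simp only [scaledMean]
  congr 1
  refine hstat.integral_shift hX h (F := fun y => f (x⁻¹ • fun i => y (τ i))) (hf.comp ?_)
  have : Measurable fun (y : ℤ → Fin d → ℝ) (i : ι) => y (τ i) :=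
    measurable_pi_lambda _ fun i => measurable_pi_apply _
  exact this.const_smul (x⁻¹ : ℝ)

/-- Union bound over the entries, all with the same tail by stationarity. The constant `c` depends
on `ν` alone. -/
theorem exists_upperTail_norm_le [IsFiniteMeasure P] (hν : IsNorm ν)
    (hstat : IsStrictlyStationary P X) (hX : ∀ t, Measurable (X t)) :
    ∃ c, 0 < c ∧ ∀ {ι : Type} [Fintype ι] [Nonempty ι] (τ : ι → ℤ) (x : ℝ),
      upperTail P (fun ω => ‖fun i => X (τ i) ω‖) x ≤
        Fintype.card ι * upperTail P (fun ω => ν (X 0 ω)) (c * x) := by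
  obtain ⟨c, hc, h⟩ := hν.exists_mul_norm_le
  refine ⟨c, hc, fun {ι} _ _ τ x => ?_⟩
  have hsub : {ω | x < ‖fun i => X (τ i) ω‖} ⊆ ⋃ i, {ω | c * x < ν (X (τ i) ω)} := by
    intro ω (hω : x < ‖fun i => X (τ i) ω‖)
    by_contra hn
    simp only [Set.mem_iUnion, Set.mem_ofPred_eq, not_exists, not_lt] at hn
    refine absurd hω (not_lt.2 ((pi_norm_le_iff_of_nonempty _).2 fun i => ?_))
    exact le_of_mul_le_mul_left ((h _).trans (hn i)) hc
  calc upperTail P (fun ω => ‖fun i => X (τ i) ω‖) x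
      ≤ P.real (⋃ i, {ω | c * x < ν (X (τ i) ω)}) := measureReal_mono hsub
    _ ≤ ∑ i, P.real {ω | c * x < ν (X (τ i) ω)} := measureReal_iUnion_fintype_le _
    _ = ∑ i : ι, upperTail P (fun ω => ν (X 0 ω)) (c * x) :=
        Finset.sum_congr rfl fun i _ => congrFun (hstat.upperTail_eq hX ν (τ i)) _
    _ = _ := by simp

/-- Tail limits of all blocks, normalised by the regularly varying tail of `‖X_0‖`. -/
def HasBlockTailLimits (P : Measure Ω) (ν : Seminorm ℝ (Fin d → ℝ)) (X : ℤ → Ω → (Fin d → ℝ))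
    (α : ℝ) : Prop :=
  TailRV (upperTail P fun ω => ν (X 0 ω)) α ∧
    ∀ k : ℕ, 1 ≤ k → HasTailLimits P (fun ω (i : Fin k) => X (((i : ℕ) : ℤ) + 1) ω)
      (upperTail P fun ω => ν (X 0 ω))

/-- Tail limits hold with the block's own normaliser `Gp`; they pass to `G` once `G / Gp` is shown
to have a nonzero limit. -/
theorem IsJointlyRegularlyVarying.hasBlockTailLimits [IsProbabilityMeasure P] (hν : IsNorm ν)
    (hX : ∀ t, Measurable (X t)) (hstat : IsStrictlyStationary P X) (hα : 0 < α)
    (h : IsJointlyRegularlyVarying P X α) : HasBlockTailLimits P ν X α := by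
  suffices H : ∀ k : ℕ, 1 ≤ k → TailRV (upperTail P fun ω => ν (X 0 ω)) α ∧
      HasTailLimits P (fun ω (i : Fin k) => X (((i : ℕ) : ℤ) + 1) ω)
        (upperTail P fun ω => ν (X 0 ω)) from ⟨(H 1 le_rfl).1, fun k hk => (H k hk).2⟩
  intro k hk
  obtain ⟨p, hp, σ, -, hconv⟩ := h k hk
  set Z : Ω → Fin k → Fin d → ℝ := fun ω i => X (((i : ℕ) : ℤ) + 1) ω with hZdef
  have hZ : Measurable Z := measurable_pi_lambda _ fun i => hX _
  have hpol := fun u hu => (tendsto_restrict_finiteLaw_iff hZ p σ hu).1 (hconv u hu)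
  have hRV := tailRV_of_polar hZ p σ hpol
  have hT := HasTailLimits.of_polar hα hZ hp σ hpol
  set G := upperTail P fun ω => ν (X 0 ω) with hGdef
  set Gp := upperTail P fun ω => p (Z ω) with hGpdef
  have : Nonempty (Fin k) := ⟨⟨0, hk⟩⟩
  have hνc := ν.continuous_of_finiteDimensional
  have hqc : Continuous fun z : Fin k → Fin d → ℝ => ν (z ⟨0, hk⟩) :=
    hνc.comp (continuous_apply _)
  obtain ⟨l, hl⟩ := hT.upperTail_ratio hα hRV (upperTail_nonneg _ _) hZ hqc
    (fun z => apply_nonneg ν _)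
    (fun c hc z => ν.smul_pos c hc _)
  have hl' : Tendsto (fun x => G x / Gp x) atTop (𝓝 l) := by
    rwa [hstat.upperTail_eq hX ν] at hl
  -- The union bound gives `Gp x ≤ k * G (c * C⁻¹ * x)`. If `l` were `0`, the right side would be
  -- negligible against `Gp x`.
  have hl0 : l ≠ 0 := by
    rintro rfl
    obtain ⟨c, hc, hdom⟩ := exists_upperTail_norm_le hν hstat hX
    obtain ⟨C, hC, hpC⟩ := p.exists_le_mul_norm
    have hle : ∀ x, Gp x ≤ k * G (c * C⁻¹ * x) := by
      intro x
      have := hdom (fun i : Fin k => ((i : ℕ) : ℤ) + 1) (C⁻¹ * x)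
      rw [Fintype.card_fin, ← mul_assoc] at this
      refine le_trans (measureReal_mono fun ω (hω : x < p (Z ω)) => ?_) this
      rw [Set.mem_ofPred_eq, inv_mul_lt_iff₀ hC]
      exact hω.trans_le (hpC _)
    have hcC : 0 < c * C⁻¹ := by positivity
    have h1 := ((hl'.comp (tendsto_id.const_mul_atTop hcC)).mul
      (hRV _ hcC)).const_mul (k : ℝ)
    rw [zero_mul, mul_zero] at h1
    have h2 := h1.eventually_lt_const one_pos
    obtain ⟨x, hx, hx0, hx1⟩ := (h2.and (hRV.eventually_ne.and
      (hRV.eventually_ne_mul hcC))).exists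
    simp only [Function.comp, id] at hx
    rw [div_mul_div_cancel₀ hx1, ← mul_div_assoc, div_lt_one
      (lt_of_le_of_ne (upperTail_nonneg _ _ _) (Ne.symm hx0))] at hx
    exact absurd (hle x) (not_le.2 hx)
  refine ⟨hRV.of_ratio hl0 hl', fun f hf hC hδ => ?_⟩
  obtain ⟨m, hm⟩ := hT f hf hC hδ
  refine ⟨_, (hm.div hl' hl0).congr' ?_⟩
  filter_upwards [hRV.eventually_ne] with x hx
  simp only [scaledMean, Pi.div_apply]
  by_cases hG0 : G x = 0
  · simp [hG0]
  · field_simp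

end

/-! ### Forward tail processes and tail limits -/

section

variable {Ω : Type*} [MeasurableSpace Ω] {P : Measure Ω} {d : ℕ}
  {ν : Seminorm ℝ (Fin d → ℝ)} {X : ℤ → Ω → (Fin d → ℝ)} {α : ℝ}

theorem integral_exceedanceLaw {ι : Type*} (hX : ∀ t, Measurable (X t)) (τ : ι → ℤ)
    {f : (ι → Fin d → ℝ) → ℝ} (hf : Measurable f) (x : ℝ) :
    ∫ v, f v ∂(exceedanceLaw P ν X τ x : Measure (ι → Fin d → ℝ)) =
      (∫ ω in {ω | x < ν (X 0 ω)}, f (fun i => x⁻¹ • X (τ i) ω) ∂P) /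
        upperTail P (fun ω => ν (X 0 ω)) x := by
  have hm : Measurable fun ω (i : ι) => x⁻¹ • X (τ i) ω :=
    measurable_pi_lambda _ fun i => (hX _).const_smul x⁻¹
  rw [exceedanceLaw, integral_finiteLaw hm hf, ProbabilityTheory.cond, integral_smul_measure,
    ENNReal.toReal_inv, smul_eq_mul, div_eq_inv_mul]
  rfl

/-- Since `a ≥ 1`, the ramp already vanishes off the conditioning event, so the restriction can be
dropped. -/
theorem exceedanceLaw_eq_scaledMean_ramp (hX : ∀ t, Measurable (X t)) {a b : ℝ} (ha : 1 ≤ a)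
    (hab : a < b) {ι : Type*} (τ : ι → ℤ) (i : ι) (hi : τ i = 0) {x : ℝ} (hx : 0 < x) :
    ∫ v, ramp a b (ν (v i)) ∂(exceedanceLaw P ν X τ x : Measure (ι → Fin d → ℝ)) =
      scaledMean P (X 0) (upperTail P fun ω => ν (X 0 ω)) (fun v => ramp a b (ν v)) x := by
  have hνm := ν.continuous_of_finiteDimensional.measurable
  have hm : Measurable fun v : ι → Fin d → ℝ => ramp a b (ν (v i)) :=
    (continuous_ramp a b).measurable.comp (hνm.comp (measurable_pi_apply i))
  rw [integral_exceedanceLaw hX τ hm, scaledMean]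
  beta_reduce
  rw [hi, ← integral_indicator (ν.measurableSet_lt_comp (hX 0) x)]
  congr 2
  ext ω
  by_cases h : x < ν (X 0 ω)
  · simp [h]
  · have : ν (x⁻¹ • X 0 ω) ≤ a := by
      rw [ν.smul_pos _ (inv_pos.2 hx), inv_mul_le_iff₀ hx]
      nlinarith
    simp [h, ramp_of_le hab this]

theorem continuous_ramp_comp_apply {ι : Type*} (ν : Seminorm ℝ (Fin d → ℝ)) (a b : ℝ) (i : ι) :
    Continuous fun v : ι → Fin d → ℝ => ramp a b (ν (v i)) :=
  (continuous_ramp a b).comp (ν.continuous_of_finiteDimensional.comp (continuous_apply i))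

/-- For `c < 1`, the quotient is the inverse of the one for `c⁻¹`, read along `c * x`. -/
theorem tailRV_of_one_le {G : ℝ → ℝ}
    (h : ∀ y : ℝ, 1 ≤ y → Tendsto (fun x => G (y * x) / G x) atTop (𝓝 (y ^ (-α)))) :
    TailRV G α := by
  intro c hc
  rcases le_total 1 c with h1 | h1
  · exact h c h1
  · have h2 := ((h c⁻¹ ((one_le_inv₀ hc).2 h1)).comp (tendsto_id.const_mul_atTop hc)).inv₀
      (Real.rpow_pos_of_pos (inv_pos.2 hc) _).ne'
    rw [Real.inv_rpow hc.le, inv_inv] at h2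
    refine h2.congr fun x => ?_
    simp only [Function.comp, id, inv_div, inv_mul_cancel_left₀ hc.ne']

theorem continuousAt_rpow_neg {y : ℝ} (hy : 0 < y) : ContinuousAt (fun z : ℝ => z ^ (-α)) y :=
  Real.continuousAt_rpow_const _ _ (Or.inl hy.ne')

theorem integral_indicator_gt {Ω' : Type*} [MeasurableSpace Ω'] {Q : Measure Ω'}
    {W : Ω' → (Fin d → ℝ)} (hW : Measurable W) (y : ℝ) :
    ∫ ω, ({v | y < ν v}.indicator fun _ => (1 : ℝ)) (W ω) ∂Q = Q.real {ω | y < ν (W ω)} := by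
  have : (fun ω => ({v | y < ν v}.indicator fun _ => (1 : ℝ)) (W ω)) =
      {ω | y < ν (W ω)}.indicator 1 := by
    ext ω
    simp [Set.indicator_apply]
  rw [this, integral_indicator_one (ν.measurableSet_lt_comp hW y)]

theorem HasParetoNorm.le_integral_ramp {Ω' : Type*} [MeasurableSpace Ω'] {Q : Measure Ω'}
    [IsProbabilityMeasure Q] {W : Ω' → (Fin d → ℝ)} (hW : Measurable W)
    (h : HasParetoNorm Q ν W α) {a b : ℝ} (ha : 1 ≤ a) (hab : a < b) :
    b ^ (-α) ≤ ∫ ω, ramp a b (ν (W ω)) ∂Q ∧ ∫ ω, ramp a b (ν (W ω)) ∂Q ≤ a ^ (-α) := by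
  have hνm := ν.continuous_of_finiteDimensional.measurable
  have hreal : ∀ y, 1 ≤ y → ∫ ω, ({v | y < ν v}.indicator fun _ => (1 : ℝ)) (W ω) ∂Q
      = y ^ (-α) := by
    intro y hy
    rw [integral_indicator_gt hW, Measure.real, h y hy,
      ENNReal.toReal_ofReal (Real.rpow_nonneg (by linarith) _)]
  have hr := (bddMeas_ramp hνm a b).integrable (P := Q) hW
  rw [← hreal b (by linarith), ← hreal a ha]
  exact ⟨integral_mono ((BddMeas.indicator_gt hνm b).integrable hW) hr
      fun ω => indicator_le_ramp hab ν _,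
    integral_mono hr ((BddMeas.indicator_gt hνm a).integrable hW)
      fun ω => ramp_le_indicator hab ν _⟩

variable {Ω' : Type*} [MeasurableSpace Ω'] {Q : Measure Ω'} [IsProbabilityMeasure Q]
  {Y : ℕ → Ω' → (Fin d → ℝ)}

/-- Only the limit law of `X_0 / x` matters: `G (y * x) / G x` is squeezed between means of ramps,
whose limits are controlled by the Pareto tail and the continuity of the power. -/
theorem IsForwardTailProcess.tailRV [IsProbabilityMeasure P] (hX : ∀ t, Measurable (X t))
    (h : IsForwardTailProcess P ν X α Q Y) : TailRV (upperTail P fun ω => ν (X 0 ω)) α := by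
  obtain ⟨hY, hpar, hconv⟩ := h
  set G := upperTail P fun ω => ν (X 0 ω) with hGdef
  have hG : ∀ x, 0 ≤ G x := upperTail_nonneg _ _
  have hνm := ν.continuous_of_finiteDimensional.measurable
  have hlim : ∀ a b : ℝ, 1 ≤ a → a < b → Tendsto
      (scaledMean P (X 0) G fun v => ramp a b (ν v)) atTop
      (𝓝 (∫ ω, ramp a b (ν (Y 0 ω)) ∂Q)) := by
    intro a b ha hab
    let f : BoundedContinuousFunction (Fin (0 + 1) → Fin d → ℝ) ℝ :=
      BoundedContinuousFunction.ofNormedAddCommGroup (fun v => ramp a b (ν (v 0)))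
        (continuous_ramp_comp_apply ν a b 0) 1 fun v => abs_ramp_le_one _ _ _
    have h1 := FiniteMeasure.tendsto_iff_forall_integral_tendsto.1 (hconv 0) f
    rw [integral_finiteLaw (measurable_pi_lambda _ fun i => hY _)
      f.continuous.measurable] at h1
    refine h1.congr' ?_
    filter_upwards [eventually_gt_atTop 0] with x hx
    exact exceedanceLaw_eq_scaledMean_ramp hX ha hab _ (0 : Fin (0 + 1)) rfl hx
  have hind : ∀ (y : ℝ) {x : ℝ}, 0 < x →
      scaledMean P (X 0) G ({v | y < ν v}.indicator fun _ => 1) x = G (y * x) / G x :=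
    fun y x hx => scaledMean_indicator_one hνm ν.smul_pos (hX 0) y hx
  refine tailRV_of_one_le fun y hy => tendsto_order.2 ⟨fun l hl => ?_, fun l hl => ?_⟩
  · obtain ⟨b, hbl, hb⟩ := ((((continuousAt_rpow_neg (α := α)
      (by linarith : 0 < y)).eventually_const_lt hl).filter_mono
      (nhdsWithin_le_nhds (s := Set.Ioi y))).and self_mem_nhdsWithin).exists
    have hb : y < b := hb
    filter_upwards [(hlim y b hy hb).eventually_const_lt
      (hbl.trans_le (hpar.le_integral_ramp (hY 0) hy hb).1), eventually_gt_atTop 0] with x h1 hx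
    rw [← hind y hx]
    exact h1.trans_le (scaledMean_mono (bddMeas_ramp hνm _ _) (BddMeas.indicator_gt hνm _) (hX 0)
      hG (fun v => ramp_le_indicator hb ν v) x)
  -- At `y = 1` no ramp with `1 ≤ a < y` exists, but the quotient is at most `1`.
  · rcases hy.eq_or_lt with rfl | hy1
    · refine Eventually.of_forall fun x => ?_
      rw [Real.one_rpow] at hl
      rw [one_mul]
      exact (div_self_le_one _).trans_lt hl
    · have h3 : ∀ᶠ z in 𝓝[<] y, z ^ (-α) < l :=
        ((continuousAt_rpow_neg (α := α) (by linarith : 0 < y)).eventually_lt_const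
          hl).filter_mono nhdsWithin_le_nhds
      have h4 : ∀ᶠ z in 𝓝[<] y, z ∈ Set.Ioo 1 y := Ioo_mem_nhdsLT hy1
      obtain ⟨a, hal, ha1, hay⟩ := (h3.and h4).exists
      filter_upwards [(hlim a y ha1.le hay).eventually_lt_const
        ((hpar.le_integral_ramp (hY 0) ha1.le hay).2.trans_lt hal),
        eventually_gt_atTop 0] with x h1 hx
      rw [← hind y hx]
      exact (scaledMean_mono (BddMeas.indicator_gt hνm _) (bddMeas_ramp hνm _ _) (hX 0)
        hG (fun v => indicator_le_ramp hay ν v) x).trans_lt h1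

/-- The threshold drops from `x` to `ε * x`: the hypothesis is used along `ε * x` with the test
function `ψ (ε • ·)`, and `G (ε * x) / G x` corrects the normalisation. -/
theorem IsForwardTailProcess.exists_tendsto [IsProbabilityMeasure P] (hX : ∀ t, Measurable (X t))
    (h : IsForwardTailProcess P ν X α Q Y) {ε : ℝ} (hε : 0 < ε) (t : ℕ)
    {ψ : (Fin (t + 1) → Fin d → ℝ) → ℝ} (hψ : Continuous ψ) (hC : ∃ C, ∀ w, |ψ w| ≤ C) :
    ∃ l, Tendsto (fun x => (∫ ω in {ω | ε * x < ν (X 0 ω)},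
      ψ (fun m => x⁻¹ • X ((m : ℕ) : ℤ) ω) ∂P) / upperTail P (fun ω => ν (X 0 ω)) x)
      atTop (𝓝 l) := by
  have hRV := h.tailRV hX
  obtain ⟨hY, hpar, hconv⟩ := h
  obtain ⟨C, hC⟩ := hC
  let f : BoundedContinuousFunction (Fin (t + 1) → Fin d → ℝ) ℝ :=
    BoundedContinuousFunction.ofNormedAddCommGroup (fun v => ψ (ε • v))
      (hψ.comp (continuous_const_smul ε)) C fun v => hC _
  have h1 := FiniteMeasure.tendsto_iff_forall_integral_tendsto.1 (hconv t) f
  refine ⟨_, ((h1.comp (tendsto_id.const_mul_atTop hε)).mul (hRV ε hε)).congr' ?_⟩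
  filter_upwards [hRV.eventually_ne_mul hε] with x hx
  simp only [Function.comp, id]
  rw [integral_exceedanceLaw hX _ f.continuous.measurable, div_mul_div_cancel₀ hx]
  congr 2
  ext ω
  refine congrArg ψ ?_
  ext m : 1
  simp only [Pi.smul_apply, smul_smul, mul_inv]
  rw [mul_inv_cancel_left₀ hε.ne']

/-- Replace the first `i` entries of a block by zero. -/
def zeroInit {k : ℕ} (i : ℕ) (z : Fin k → Fin d → ℝ) : Fin k → Fin d → ℝ :=
  fun j => if (j : ℕ) < i then 0 else z j

theorem continuous_zeroInit {k : ℕ} (i : ℕ) :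
    Continuous (zeroInit i : (Fin k → Fin d → ℝ) → _) := by
  refine continuous_pi fun j => ?_
  by_cases h : (j : ℕ) < i
  · simpa [zeroInit, h] using continuous_const
  · simpa [zeroInit, h] using continuous_apply j

theorem norm_zeroInit_le {k : ℕ} (i : ℕ) (z : Fin k → Fin d → ℝ) : ‖zeroInit i z‖ ≤ ‖z‖ := by
  refine (pi_norm_le_iff_of_nonneg (norm_nonneg z)).2 fun j => ?_
  by_cases h : (j : ℕ) < i
  · simp [zeroInit, h]
  · simpa [zeroInit, h] using norm_le_pi_norm z j

theorem norm_zeroInit_sub_le {k : ℕ} (i : Fin k) (z : Fin k → Fin d → ℝ) :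
    ‖zeroInit i z - zeroInit (i + 1) z‖ ≤ ‖z i‖ := by
  refine (pi_norm_le_iff_of_nonneg (norm_nonneg _)).2 fun j => ?_
  rcases lt_trichotomy (j : ℕ) i with h | h | h
  · simp [zeroInit, h, h.trans (Nat.lt_succ_self _)]
  · have : j = i := Fin.ext h
    simp [zeroInit, this]
  · have h1 : ¬ (j : ℕ) < i := by omega
    have h2 : ¬ (j : ℕ) < i + 1 := by omega
    simp [zeroInit, h1, h2]

/-- A telescoping sum whose `i`-th term ignores the entries before `i`; this is what makes purely
forward information sufficient. -/
theorem sum_zeroInit {k : ℕ} (f : (Fin k → Fin d → ℝ) → ℝ) (h0 : f 0 = 0)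
    (z : Fin k → Fin d → ℝ) :
    ∑ i : Fin k, (f (zeroInit i z) - f (zeroInit (i + 1) z)) = f z := by
  rw [Fin.sum_univ_eq_sum_range (fun i => f (zeroInit i z) - f (zeroInit (i + 1) z)) k,
    Finset.sum_range_sub' (fun i => f (zeroInit i z))]
  have h1 : zeroInit 0 z = z := by ext j; simp [zeroInit]
  have h2 : zeroInit k z = 0 := by ext j; simp [zeroInit]
  rw [h1, h2, h0, sub_zero]

/-- Put a block behind `i` leading zeros. -/
def padInit {k : ℕ} (i : ℕ) (w : Fin (k + 1) → Fin d → ℝ) : Fin k → Fin d → ℝ :=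
  fun j => if (j : ℕ) < i then 0 else w ⟨j - i, by omega⟩

theorem continuous_padInit {k : ℕ} (i : ℕ) :
    Continuous (padInit i : (Fin (k + 1) → Fin d → ℝ) → _) := by
  refine continuous_pi fun j => ?_
  by_cases h : (j : ℕ) < i
  · simpa [padInit, h] using continuous_const
  · simpa [padInit, h] using continuous_apply _

/-- Stationarity moves entry `i` to time zero. The erased entries are exactly those at negative
times, so the forward limit applies. -/
theorem IsForwardTailProcess.exists_tendsto_term [IsProbabilityMeasure P]
    (hX : ∀ t, Measurable (X t)) (hstat : IsStrictlyStationary P X)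
    (h : IsForwardTailProcess P ν X α Q Y) {ε : ℝ} (hε : 0 < ε) {k : ℕ} (i : Fin k)
    {f : (Fin k → Fin d → ℝ) → ℝ} (hf : Continuous f) (hC : ∃ C, ∀ z, |f z| ≤ C) :
    ∃ l, Tendsto (scaledMean P (fun ω (j : Fin k) => X (((j : ℕ) : ℤ) + 1) ω)
      (upperTail P fun ω => ν (X 0 ω)) ({z | ε < ν (z i)}.indicator fun z =>
        f (zeroInit i z) - f (zeroInit (i + 1) z))) atTop (𝓝 l) := by
  have hνm := ν.continuous_of_finiteDimensional.measurable
  have hd : Continuous fun z : Fin k → Fin d → ℝ => f (zeroInit i z) - f (zeroInit (i + 1) z) :=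
    (hf.comp (continuous_zeroInit _)).sub (hf.comp (continuous_zeroInit _))
  obtain ⟨C, hC⟩ := hC
  obtain ⟨l, hl⟩ := h.exists_tendsto hX hε k
    (ψ := fun w => f (padInit i w) - f (zeroInit (i + 1) (padInit i w)))
    ((hf.comp (continuous_padInit _)).sub
      (hf.comp ((continuous_zeroInit _).comp (continuous_padInit _))))
    ⟨C + C, fun w => (abs_sub _ _).trans (add_le_add (hC _) (hC _))⟩
  refine ⟨l, hl.congr' ?_⟩
  filter_upwards [eventually_gt_atTop 0] with x hx
  have hmeas : Measurable ({z : Fin k → Fin d → ℝ | ε < ν (z i)}.indicator fun z =>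
      f (zeroInit i z) - f (zeroInit (i + 1) z)) :=
    hd.measurable.indicator
      (measurableSet_lt measurable_const (hνm.comp (measurable_pi_apply i)))
  -- Entry `j` of the block sits at time `j + 1`, hence the shift by `i + 1`.
  have hshift := hstat.scaledMean_shift hX (i + 1) (fun j : Fin k => ((j : ℕ) : ℤ) - i)
    (upperTail P fun ω => ν (X 0 ω)) hmeas x
  have hidx : (fun ω (j : Fin k) => X (((j : ℕ) : ℤ) - i + (i + 1)) ω) =
      fun ω (j : Fin k) => X (((j : ℕ) : ℤ) + 1) ω := by
    ext ω j : 2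
    congr 1
    ring
  rw [hidx] at hshift
  rw [hshift, scaledMean, ← integral_indicator (ν.measurableSet_lt_comp (hX 0) _)]
  congr 2
  ext ω
  have h1 : ε < ν (x⁻¹ • X (((i : ℕ) : ℤ) - i) ω) ↔ ε * x < ν (X 0 ω) := by
    rw [sub_self, ν.smul_pos _ (inv_pos.2 hx), inv_mul_eq_div, lt_div_iff₀ hx]
  have h2 : zeroInit i (x⁻¹ • fun j : Fin k => X (((j : ℕ) : ℤ) - i) ω) =
      padInit i (fun m : Fin (k + 1) => x⁻¹ • X ((m : ℕ) : ℤ) ω) := by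
    ext j : 1
    by_cases hj : (j : ℕ) < i
    · simp [zeroInit, padInit, hj]
    · simp [zeroInit, padInit, hj, Nat.cast_sub (not_lt.1 hj)]
  -- This rewrites the second term, too, as a function of the padded forward block.
  have h3 : ∀ z : Fin k → Fin d → ℝ, zeroInit (i + 1) (zeroInit i z) = zeroInit (i + 1) z := by
    intro z
    ext j : 1
    by_cases hj : (j : ℕ) < i + 1
    · simp [zeroInit, hj]
    · have : ¬ (j : ℕ) < i := by omega
      simp [zeroInit, hj, this]
  simp only [Set.indicator_apply, Set.mem_ofPred_eq, Pi.smul_apply, h1]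
  rw [← h3 (x⁻¹ • fun j : Fin k => X (((j : ℕ) : ℤ) - i) ω), h2]

theorem IsForwardTailProcess.hasBlockTailLimits [IsProbabilityMeasure P] (hν : IsNorm ν)
    (hX : ∀ t, Measurable (X t)) (hstat : IsStrictlyStationary P X) (hα : 0 < α)
    (h : IsForwardTailProcess P ν X α Q Y) : HasBlockTailLimits P ν X α := by
  have hRV := h.tailRV hX
  refine ⟨hRV, fun k hk => ?_⟩
  set G := upperTail P fun ω => ν (X 0 ω) with hGdef
  have hG : ∀ x, 0 ≤ G x := upperTail_nonneg _ _
  have hZ : Measurable fun ω (j : Fin k) => X (((j : ℕ) : ℤ) + 1) ω :=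
    measurable_pi_lambda _ fun i => hX _
  have hνm := ν.continuous_of_finiteDimensional.measurable
  have : Nonempty (Fin k) := ⟨⟨0, hk⟩⟩
  obtain ⟨c, hc, hdom⟩ := exists_upperTail_norm_le hν hstat hX
  have hdom := hdom (fun j : Fin k => ((j : ℕ) : ℤ) + 1)
  refine HasTailLimits.of_hasCompactSupport hα hZ hG hRV hc hdom fun f hf hfs ⟨δ, hδ, hδ0⟩ => ?_
  obtain ⟨D, hD⟩ := hfs.exists_bound_of_continuous hf
  have hfB : BddMeas f := BddMeas.of_continuous hf ⟨D, hD⟩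
  have h0 : f 0 = 0 := hδ0 0 (by simpa using hδ)
  obtain ⟨c', hc', hνc⟩ := hν.exists_mul_norm_le
  refine exists_tendsto_scaledMean_of_approx hZ hG hfB fun ε hε => ?_
  -- `B` eventually bounds the normalised mass of `{δ / 2 < ‖z‖}`; `η` is then fixed by `k * η * B =
  -- ε`.
  set B := (Fintype.card (Fin k) : ℝ) * (c * (δ / 2)) ^ (-α) + 1 with hB
  have hB0 : 0 < B := by positivity
  have hk0 : (0 : ℝ) < k := by exact_mod_cast hk
  set η := ε / (k * B) with hη
  have hη0 : 0 < η := by positivity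
  obtain ⟨ρ, hρ, hunif⟩ := Metric.uniformContinuous_iff.1
    (hfs.uniformContinuous_of_continuous hf) η hη0
  have hε' : 0 < c' * ρ / 2 := by positivity
  have hdB : ∀ i : Fin k, BddMeas fun z : Fin k → Fin d → ℝ =>
      f (zeroInit i z) - f (zeroInit (i + 1) z) := fun i =>
    (hfB.comp (continuous_zeroInit _).measurable).sub (hfB.comp (continuous_zeroInit _).measurable)
  have hms : ∀ i : Fin k, MeasurableSet {z : Fin k → Fin d → ℝ | c' * ρ / 2 < ν (z i)} :=
    fun i => measurableSet_lt measurable_const (hνm.comp (measurable_pi_apply i))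
  have hsumB : ∀ s : Finset (Fin k), BddMeas fun z : Fin k → Fin d → ℝ => ∑ i ∈ s,
      ({z | c' * ρ / 2 < ν (z i)}.indicator fun z =>
        f (zeroInit i z) - f (zeroInit (i + 1) z)) z := by
    intro s
    induction s using Finset.induction_on with
    | empty => simpa using BddMeas.const (0 : ℝ)
    | insert j s hj ih =>
      simp only [Finset.sum_insert hj]
      exact ((hdB j).indicator (hms j)).add ih
  refine ⟨_, fun z => k * η * ({z : Fin k → Fin d → ℝ | δ / 2 < ‖z‖}.indicator fun _ => 1) z,
    hsumB Finset.univ, (BddMeas.indicator_gt measurable_norm _).const_mul _, fun z => ?_, ?_, ?_⟩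
  · conv_lhs => rw [← sum_zeroInit f h0 z]
    rw [← Finset.sum_sub_distrib]
    refine (Finset.abs_sum_le_sum_abs _ _).trans ?_
    have : (k : ℝ) * η * ({z : Fin k → Fin d → ℝ | δ / 2 < ‖z‖}.indicator fun _ => 1) z =
        ∑ i : Fin k, η * ({z : Fin k → Fin d → ℝ | δ / 2 < ‖z‖}.indicator fun _ => 1) z := by
      simp [mul_assoc]
    beta_reduce
    rw [this]
    refine Finset.sum_le_sum fun i _ => ?_
    -- If entry `i` is large the two terms agree. Otherwise erasing it moves the block by less than
    -- `ρ`, and near the origin both values of `f` vanish.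
    by_cases hzi : c' * ρ / 2 < ν (z i)
    · simp only [Set.indicator_apply, Set.mem_ofPred_eq, hzi, if_true, sub_self, abs_zero]
      split_ifs <;> simp [hη0.le]
    · have hsm : ({z | c' * ρ / 2 < ν (z i)}.indicator fun z : Fin k → Fin d → ℝ =>
        f (zeroInit i z) - f (zeroInit (i + 1) z)) z = 0 := by simp [hzi]
      rw [hsm, sub_zero]
      by_cases hz : δ / 2 < ‖z‖
      · simp only [Set.indicator_apply, Set.mem_ofPred_eq, hz, if_true, mul_one]
        refine (hunif ?_).le
        rw [dist_eq_norm]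
        refine (norm_zeroInit_sub_le i z).trans_lt ?_
        have := (hνc (z i)).trans (not_lt.1 hzi)
        have : ‖z i‖ ≤ ρ / 2 := by
          refine le_of_mul_le_mul_left (this.trans_eq ?_) hc'
          ring
        linarith
      · rw [hδ0 _ ((norm_zeroInit_le _ _).trans_lt (by linarith)),
          hδ0 _ ((norm_zeroInit_le _ _).trans_lt (by linarith))]
        simp [hz]
  · choose l hl using fun i : Fin k => h.exists_tendsto_term hX hstat hε' i hf ⟨D, hD⟩
    refine ⟨_, (tendsto_finsetSum Finset.univ fun i _ => hl i).congr fun x => ?_⟩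
    exact (scaledMean_sum _ (fun i _ => (hdB i).indicator (hms i)) hZ x).symm
  · filter_upwards [eventually_scaledMean_norm_le hZ hG hRV hc hdom (half_pos hδ)
      (lt_add_one _)] with x hx
    rw [scaledMean_const_mul]
    calc _ ≤ k * η * B := mul_le_mul_of_nonneg_left hx (by positivity)
      _ = ε := by rw [hη]; field_simp

end

/-! ### Cluster points of conditional laws -/

theorem MapClusterPt.eq_of_tendsto {F : ℝ → ℝ} {a b : ℝ} (h : MapClusterPt a atTop F)
    (hb : Tendsto F atTop (𝓝 b)) : a = b := by
  have : ClusterPt a (𝓝 b) := ClusterPt.mono h hb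
  exact eq_of_nhds_neBot this

/-- Compactness yields cluster points only; this identifies their integrals wherever the integrals
are known to converge. -/
theorem MapClusterPt.integral_eq {E : Type*} [TopologicalSpace E] [MeasurableSpace E]
    [OpensMeasurableSpace E] {μ : ℝ → ProbabilityMeasure E} {σ : ProbabilityMeasure E}
    (h : MapClusterPt σ atTop μ) (g : BoundedContinuousFunction E ℝ) {l : ℝ}
    (hl : Tendsto (fun x => ∫ v, g v ∂(μ x : Measure E)) atTop (𝓝 l)) :
    ∫ v, g v ∂(σ : Measure E) = l :=
  (h.continuousAt_comp
    (ProbabilityMeasure.continuous_integral_boundedContinuousFunction g).continuousAt).eq_of_tendsto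
    hl

theorem TailRV.pos {G : ℝ → ℝ} {α : ℝ} (h : TailRV G α) (hanti : Antitone G)
    (hG : ∀ x, 0 ≤ G x) (x : ℝ) : 0 < G x := by
  obtain ⟨y, hy, hxy⟩ := (h.eventually_ne.and (eventually_ge_atTop x)).exists
  exact (lt_of_le_of_ne (hG y) (Ne.symm hy)).trans_le (hanti hxy)

section

variable {Ω : Type*} [MeasurableSpace Ω] {P : Measure Ω}

/-- The law of `W` conditionally on an event of positive probability. -/
noncomputable def conditionalLaw {E : Type*} [MeasurableSpace E] (P : Measure Ω)
    [IsFiniteMeasure P] {A : Set Ω} (hA : 0 < P.real A) {W : Ω → E} (hW : Measurable W) :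
    ProbabilityMeasure E :=
  ⟨(P[|A]).map W, by
    have : IsProbabilityMeasure (P[|A]) := cond_isProbabilityMeasure fun h0 => by
      simp [Measure.real, h0] at hA
    exact Measure.isProbabilityMeasure_map hW.aemeasurable⟩

theorem integral_conditionalLaw {E : Type*} [MeasurableSpace E] [IsFiniteMeasure P] {A : Set Ω}
    (hA : 0 < P.real A) {W : Ω → E} (hW : Measurable W) {f : E → ℝ} (hf : Measurable f) :
    ∫ v, f v ∂(conditionalLaw P hA hW : Measure E) = (∫ ω in A, f (W ω) ∂P) / P.real A := by
  have : ∫ v, f v ∂(conditionalLaw P hA hW : Measure E) = ∫ ω, f (W ω) ∂(P[|A]) :=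
    integral_map hW.aemeasurable hf.aestronglyMeasurable
  rw [this, ProbabilityTheory.cond, integral_smul_measure, ENNReal.toReal_inv, smul_eq_mul,
    div_eq_inv_mul]
  rfl

theorem conditionalLaw_apply_le {E : Type*} [MeasurableSpace E] [IsFiniteMeasure P] {A : Set Ω}
    (hA : 0 < P.real A) {W : Ω → E} (hW : Measurable W) {s : Set E} (hs : MeasurableSet s) :
    (conditionalLaw P hA hW : Measure E) s ≤ ENNReal.ofReal (P.real (W ⁻¹' s) / P.real A) := by
  have h1 : (conditionalLaw P hA hW : Measure E) s = P[W ⁻¹' s | A] := Measure.map_apply hW hs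
  rw [h1, cond_apply' (hW hs), div_eq_inv_mul, ENNReal.ofReal_mul (inv_nonneg.2 hA.le),
    ENNReal.ofReal_inv_of_pos hA, Measure.real, Measure.real,
    ENNReal.ofReal_toReal (measure_ne_top _ _), ENNReal.ofReal_toReal (measure_ne_top _ _)]
  exact mul_le_mul_right (measure_mono Set.inter_subset_right) _

/-! ### Tail limits imply joint regular variation -/

/-- The sum of the norms of the entries of a block. -/
noncomputable def blockNorm {d : ℕ} (ν : Seminorm ℝ (Fin d → ℝ)) (k : ℕ) :
    Seminorm ℝ (Fin k → Fin d → ℝ) :=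
  Seminorm.of (fun z => ∑ i, ν (z i))
    (fun x y => by
      rw [← Finset.sum_add_distrib]
      exact Finset.sum_le_sum fun i _ => map_add_le_add ν _ _)
    (fun a x => by
      rw [Finset.mul_sum]
      exact Finset.sum_congr rfl fun i _ => map_smul_eq_mul ν _ _)

theorem blockNorm_apply {d : ℕ} (ν : Seminorm ℝ (Fin d → ℝ)) {k : ℕ}
    (z : Fin k → Fin d → ℝ) : blockNorm ν k z = ∑ i, ν (z i) := rfl

theorem IsNorm.blockNorm {d : ℕ} {ν : Seminorm ℝ (Fin d → ℝ)} (hν : IsNorm ν) (k : ℕ) :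
    IsNorm (blockNorm ν k) := by
  intro z hz
  rw [blockNorm_apply, Finset.sum_eq_zero_iff_of_nonneg fun i _ => apply_nonneg ν _] at hz
  exact funext fun i => hν _ (hz i (Finset.mem_univ i))

/-- The hypothesis `hGp` forces the limit of `H / G` to be at least `1`, so `H` may replace `G` as
normaliser. The spectral law is a cluster point of the directional laws, and general `u` follows
from `u = 1` by rescaling. -/
theorem isRegularlyVarying_of_hasTailLimits {V : Type*} [NormedAddCommGroup V] [NormedSpace ℝ V]
    [FiniteDimensional ℝ V] [MeasurableSpace V] [BorelSpace V] [IsProbabilityMeasure P]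
    {Z : Ω → V} (hZ : Measurable Z) {G : ℝ → ℝ} {α : ℝ} (hα : 0 < α) (hG : ∀ x, 0 ≤ G x)
    (hRV : TailRV G α) (hT : HasTailLimits P Z G) {p : Seminorm ℝ V} (hp : IsNorm p)
    (hGp : ∀ x, G x ≤ upperTail P (fun ω => p (Z ω)) x) : IsRegularlyVarying P Z α := by
  set H := upperTail P fun ω => p (Z ω) with hH
  have hpc := p.continuous_of_finiteDimensional
  obtain ⟨l, hl⟩ := hT.upperTail_ratio hα hRV hG hZ hpc (fun v => apply_nonneg p v) p.smul_pos
  change Tendsto (fun x => H x / G x) atTop (𝓝 l) at hl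
  have hl1 : 1 ≤ l := by
    refine ge_of_tendsto hl ?_
    filter_upwards [hRV.eventually_ne] with x hx
    rw [one_le_div (lt_of_le_of_ne (hG x) (Ne.symm hx))]
    exact hGp x
  have hl0 : l ≠ 0 := by linarith
  have hRVp : TailRV H α := hRV.of_ratio hl0 hl
  have hpos : ∀ x, 0 < H x := hRVp.pos (upperTail_anti P _) (upperTail_nonneg P _)
  have hW : Measurable fun ω => (p (Z ω))⁻¹ • Z ω := (measurable_normalize p).comp hZ
  let μ : ℝ → ProbabilityMeasure V := fun x => conditionalLaw P (hpos x) hW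
  have hμ : ∀ (g : BoundedContinuousFunction V ℝ) {x : ℝ}, 0 < x →
      ∫ v, g v ∂(μ x : Measure V) = scaledMean P Z H (polarFun p 1 g) x := by
    intro g x hx
    rw [scaledMean_polarFun hZ p 1 g hx,
      integral_conditionalLaw (hpos x) hW g.continuous.measurable, one_mul]
    rfl
  have hconv : ∀ g : BoundedContinuousFunction V ℝ,
      ∃ m, Tendsto (scaledMean P Z H (polarFun p 1 g)) atTop (𝓝 m) := by
    intro g
    -- The maximum removes the singularity at the origin and changes nothing on `{1 < p z}`.
    have hf : Continuous fun z => g ((max (p z) 1)⁻¹ • z) := by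
      refine g.continuous.comp (Continuous.smul (Continuous.inv₀ (hpc.max continuous_const)
        fun z => ?_) continuous_id)
      exact (lt_of_lt_of_le one_pos (le_max_right _ _)).ne'
    obtain ⟨m, hm⟩ := hT.indicator hα hRV hG hZ hpc (fun v => apply_nonneg p v) p.smul_pos hf
      ⟨‖g‖, fun v => g.norm_coe_le_norm _⟩
    have he : ({v | 1 < p v}.indicator fun z => g ((max (p z) 1)⁻¹ • z)) = polarFun p 1 g := by
      ext z
      by_cases hz : 1 < p z
      · simp [polarFun, hz, max_eq_left hz.le]
      · simp [polarFun, hz]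
    rw [he] at hm
    refine ⟨_, (hm.div hl hl0).congr' ?_⟩
    filter_upwards [hRV.eventually_ne] with x hx
    have := (hpos x).ne'
    simp only [scaledMean, Pi.div_apply]
    field_simp
  set K : Set V := {v | p v = 1} with hK
  have hKm : MeasurableSet K := hp.isCompact_sphere.measurableSet
  have hcomp : IsCompact {σ : ProbabilityMeasure V | ∀ n : ℕ, σ ((fun _ : ℕ => K) n)ᶜ ≤ 0} :=
    isCompact_setOfPred_probabilityMeasure_mass_eq_compl_isCompact_le tendsto_const_nhds
      (fun _ => hp.isCompact_sphere) (Or.inr monotone_const)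
  -- With a nonnegative threshold the conditioning event excludes `p (Z ω) = 0`, so every law in the
  -- family is carried by the sphere.
  obtain ⟨σ, hσK, hσ⟩ := hcomp.exists_mapClusterPt (f := atTop.map (fun x : ℝ => max x 0))
    (u := μ) (by
      rw [le_principal_iff, mem_map, mem_map]
      refine Eventually.of_forall fun x n => ?_
      rw [← ENNReal.coe_le_coe, ProbabilityMeasure.ennreal_coeFn_eq_coeFn_toMeasure]
      have h0 : 0 ≤ max x 0 := le_max_right _ _
      have hms : MeasurableSet {ω | max x 0 < p (Z ω)} := p.measurableSet_lt_comp hZ _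
      have h1 : (μ (max x 0) : Measure V) Kᶜ =
          P[(fun ω => (p (Z ω))⁻¹ • Z ω) ⁻¹' Kᶜ | {ω | max x 0 < p (Z ω)}] :=
        Measure.map_apply hW hKm.compl
      simp only [h1, cond_apply hms, ENNReal.coe_zero, nonpos_iff_eq_zero]
      have h2 : {ω | max x 0 < p (Z ω)} ∩ (fun ω => (p (Z ω))⁻¹ • Z ω) ⁻¹' Kᶜ = ∅ := by
        rw [Set.eq_empty_iff_forall_notMem]
        rintro ω ⟨h3, h4⟩
        have h5 : 0 < p (Z ω) := h0.trans_lt h3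
        refine h4 ?_
        change p _ = 1
        rw [p.smul_pos _ (inv_pos.2 h5), inv_mul_cancel₀ h5.ne']
      rw [h2, measure_empty, mul_zero])
  have hmax : map (fun x : ℝ => max x 0) atTop ≤ atTop :=
    tendsto_atTop_mono (fun x => le_max_left x 0) tendsto_id
  have hσ : MapClusterPt σ atTop μ := ClusterPt.mono hσ (map_mono hmax)
  refine ⟨p, hp, σ, ?_, fun u hu => (tendsto_restrict_finiteLaw_iff hZ p σ hu).2 fun g => ?_⟩
  · have h0 : σ Kᶜ = 0 := nonpos_iff_eq_zero.1 (hσK 0)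
    have := prob_compl_eq_zero_iff (μ := (σ : Measure V)) hKm
    rw [← ENNReal.coe_inj, ProbabilityMeasure.ennreal_coeFn_eq_coeFn_toMeasure,
      ENNReal.coe_one, ← this, ← ProbabilityMeasure.ennreal_coeFn_eq_coeFn_toMeasure, h0,
      ENNReal.coe_zero]
  · obtain ⟨m, hm⟩ := hconv g
    have hint : ∫ v, g v ∂(σ : Measure V) = m := hσ.integral_eq g (hm.congr' (by
      filter_upwards [eventually_gt_atTop 0] with x hx
      exact (hμ g hx).symm))
    rw [hint, mul_comm]
    refine ((hm.comp (tendsto_id.const_mul_atTop hu)).mul (hRVp u hu)).congr' ?_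
    filter_upwards [eventually_gt_atTop 0] with x hx
    simp only [Function.comp, id]
    rw [scaledMean_polarFun hZ p u g hx, scaledMean_polarFun hZ p 1 g (mul_pos hu hx), one_mul,
      div_mul_div_cancel₀ (hpos _).ne']

/-- The norm `blockNorm` dominates that of each entry, so by stationarity its tail dominates `G`. -/
theorem HasBlockTailLimits.isJointlyRegularlyVarying [IsProbabilityMeasure P] {d : ℕ}
    {ν : Seminorm ℝ (Fin d → ℝ)} (hν : IsNorm ν) {X : ℤ → Ω → (Fin d → ℝ)}
    (hX : ∀ t, Measurable (X t)) (hstat : IsStrictlyStationary P X) {α : ℝ} (hα : 0 < α)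
    (h : HasBlockTailLimits P ν X α) : IsJointlyRegularlyVarying P X α := by
  intro k hk
  have hZ : Measurable fun ω (j : Fin k) => X (((j : ℕ) : ℤ) + 1) ω :=
    measurable_pi_lambda _ fun i => hX _
  refine isRegularlyVarying_of_hasTailLimits hZ hα (upperTail_nonneg _ _) h.1 (h.2 k hk)
    (hν.blockNorm k) fun x => ?_
  rw [← hstat.upperTail_eq hX ν ((((⟨0, hk⟩ : Fin k) : ℕ) : ℤ) + 1)]
  refine measureReal_mono fun ω (hω : x < _) => Set.mem_ofPred.2 (hω.trans_le ?_)
  beta_reduce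
  rw [blockNorm_apply]
  exact Finset.single_le_sum (f := fun i : Fin k => ν (X (((i : ℕ) : ℤ) + 1) ω))
    (fun i _ => apply_nonneg ν _) (Finset.mem_univ _)

end

/-! ### Existence of the tail process -/

section

variable {Ω : Type*} [MeasurableSpace Ω] {P : Measure Ω} {d : ℕ}
  {ν : Seminorm ℝ (Fin d → ℝ)} {X : ℤ → Ω → (Fin d → ℝ)} {α : ℝ}

/-- By stationarity a block of length `2 * N + 1` may be centred at time zero; conditioning then
becomes the indicator that its middle entry exceeds `1`. -/
theorem HasBlockTailLimits.exists_tendsto_exceedanceLaw [IsProbabilityMeasure P]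
    (hX : ∀ t, Measurable (X t)) (hstat : IsStrictlyStationary P X) (hα : 0 < α)
    (h : HasBlockTailLimits P ν X α) (s t : ℤ)
    (f : BoundedContinuousFunction (Finset.Icc s t → Fin d → ℝ) ℝ) :
    ∃ l, Tendsto (fun x => ∫ v, f v ∂(exceedanceLaw P ν X
      (fun i : Finset.Icc s t => (i : ℤ)) x : Measure (Finset.Icc s t → Fin d → ℝ)))
      atTop (𝓝 l) := by
  obtain ⟨hRV, hT⟩ := h
  -- This choice puts all times from `s` to `t` inside `[-N, N]`.
  set N : ℕ := s.natAbs + t.natAbs with hN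
  have hT := hT (2 * N + 1) (by omega)
  set G := upperTail P fun ω => ν (X 0 ω) with hG
  have hνc := ν.continuous_of_finiteDimensional
  have hidx : ∀ j : Finset.Icc s t, ((j : ℤ) + N).toNat < 2 * N + 1 := by
    rintro ⟨j, hj⟩
    rw [Finset.mem_Icc] at hj
    simp only
    omega
  let i₀ : Fin (2 * N + 1) := ⟨N, by omega⟩
  let r : (Fin (2 * N + 1) → Fin d → ℝ) → (Finset.Icc s t → Fin d → ℝ) :=
    fun z j => z ⟨((j : ℤ) + N).toNat, hidx j⟩
  have hr : Continuous r := continuous_pi fun j => continuous_apply _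
  have hq : Continuous fun z : Fin (2 * N + 1) → Fin d → ℝ => ν (z i₀) :=
    hνc.comp (continuous_apply _)
  have hfr : Continuous fun z => f (r z) := f.continuous.comp hr
  have hZ : Measurable fun ω (j : Fin (2 * N + 1)) => X (((j : ℕ) : ℤ) + 1) ω :=
    measurable_pi_lambda _ fun i => hX _
  obtain ⟨l, hl⟩ := hT.indicator hα hRV (upperTail_nonneg _ _) hZ hq
    (fun z => apply_nonneg ν _) (fun c hc z => ν.smul_pos c hc _) hfr
    ⟨‖f‖, fun v => f.norm_coe_le_norm _⟩
  refine ⟨l, hl.congr' ?_⟩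
  filter_upwards [eventually_gt_atTop 0] with x hx
  have hmeas : Measurable ({z : Fin (2 * N + 1) → Fin d → ℝ | 1 < ν (z i₀)}.indicator
      fun z => f (r z)) :=
    hfr.measurable.indicator (measurableSet_lt measurable_const hq.measurable)
  have hshift := hstat.scaledMean_shift hX (N + 1) (fun j : Fin (2 * N + 1) => ((j : ℕ) : ℤ) - N)
    G hmeas x
  have he : (fun ω (j : Fin (2 * N + 1)) => X (((j : ℕ) : ℤ) - N + (N + 1)) ω) =
      fun ω (j : Fin (2 * N + 1)) => X (((j : ℕ) : ℤ) + 1) ω := by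
    ext ω j : 2
    congr 1
    ring
  rw [he] at hshift
  rw [hshift, integral_exceedanceLaw hX _ f.continuous.measurable, scaledMean,
    ← integral_indicator (ν.measurableSet_lt_comp (hX 0) _)]
  congr 2
  ext ω
  have h1 : 1 < ν ((x⁻¹ • fun j : Fin (2 * N + 1) => X (((j : ℕ) : ℤ) - N) ω) i₀) ↔
      x < ν (X 0 ω) := by
    simp only [Pi.smul_apply, i₀, sub_self]
    rw [ν.smul_pos _ (inv_pos.2 hx), inv_mul_eq_div, lt_div_iff₀ hx, one_mul]
  have h2 : r (x⁻¹ • fun j : Fin (2 * N + 1) => X (((j : ℕ) : ℤ) - N) ω) =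
      fun j : Finset.Icc s t => x⁻¹ • X (j : ℤ) ω := by
    ext j : 1
    simp only [r, Pi.smul_apply]
    congr 2
    have := j.2
    rw [Finset.mem_Icc] at this
    omega
  simp only [Set.indicator_apply, Set.mem_ofPred_eq, h1, h2]

/-- A uniform geometric bound for regularly varying tails along powers of two. -/
theorem TailRV.exists_geometric_bound {G : ℝ → ℝ} (h : TailRV G α) (hα : 0 < α)
    (hG : ∀ x, 0 < G x) :
    ∃ c x₀ : ℝ, 0 < c ∧ c < 1 ∧ 0 < x₀ ∧ ∀ x ≥ x₀, ∀ n : ℕ, G (2 ^ n * x) / G x ≤ c ^ n := by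
  have h2 : (2 : ℝ) ^ (-α) < 1 := Real.rpow_lt_one_of_one_lt_of_neg one_lt_two (by linarith)
  obtain ⟨c, hc, hc1⟩ := exists_between h2
  have hc0 : 0 < c := (Real.rpow_pos_of_pos two_pos _).trans hc
  obtain ⟨x₀, hx₀⟩ := (((h 2 two_pos).eventually_lt_const hc).and
    (eventually_gt_atTop 0)).exists_forall_of_atTop
  refine ⟨c, x₀, hc0, hc1, (hx₀ x₀ le_rfl).2, fun x hx n => ?_⟩
  have hx0 : 0 < x := (hx₀ x hx).2
  induction n with
  | zero => simp [div_self (hG x).ne']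
  | succ n ih =>
    have h3 : x₀ ≤ 2 ^ n * x := hx.le.trans (le_mul_of_one_le_left hx0.le (one_le_pow₀ one_le_two))
    have h4 := (hx₀ _ h3).1.le
    rw [← mul_assoc, ← pow_succ'] at h4
    calc G (2 ^ (n + 1) * x) / G x
        = G (2 ^ (n + 1) * x) / G (2 ^ n * x) * (G (2 ^ n * x) / G x) :=
          (div_mul_div_cancel₀ (hG _).ne').symm
      _ ≤ c * c ^ n := mul_le_mul h4 ih (div_nonneg (hG _).le (hG _).le) hc0.le
      _ = c ^ (n + 1) := (pow_succ' c n).symm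

theorem isCompact_pi_seminorm_le {ι : Type*} (hν : IsNorm ν) (R : ι → ℝ) :
    IsCompact {y : ι → Fin d → ℝ | ∀ t, ν (y t) ≤ R t} := by
  obtain ⟨c, hc, h⟩ := hν.exists_mul_norm_le
  have : {y : ι → Fin d → ℝ | ∀ t, ν (y t) ≤ R t} = Set.pi Set.univ fun t => {v | ν v ≤ R t} := by
    ext y
    simp [Set.mem_pi]
  rw [this]
  refine isCompact_univ_pi fun t => Metric.isCompact_of_isClosed_isBounded
    (isClosed_le ν.continuous_of_finiteDimensional continuous_const) ?_
  refine (Metric.isBounded_closedBall (x := 0) (r := R t / c)).subset fun v hv => ?_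
  rw [mem_closedBall_zero_iff, le_div_iff₀ hc, mul_comm]
  exact (h v).trans hv

theorem measurable_path (hX : ∀ t, Measurable (X t)) (x : ℝ) :
    Measurable fun ω (t : ℤ) => x⁻¹ • X t ω :=
  measurable_pi_lambda _ fun t => (hX t).const_smul x⁻¹

/-- Dropping the conditioning event from the numerator, stationarity bounds the exceedance of `2 ^
m` at any time by `G (2 ^ m * x) / G x ≤ c ^ m`. Encoding the times by naturals makes these bounds
summable, and the result does not depend on `x`. -/
theorem conditionalLaw_path_compl_le [IsProbabilityMeasure P] (hX : ∀ t, Measurable (X t))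
    (hstat : IsStrictlyStationary P X)
    (hpos : ∀ x, 0 < upperTail P (fun ω => ν (X 0 ω)) x) {c x : ℝ} (hc : 0 < c) (hx : 0 < x)
    (hgeo : ∀ n : ℕ, upperTail P (fun ω => ν (X 0 ω)) (2 ^ n * x) /
      upperTail P (fun ω => ν (X 0 ω)) x ≤ c ^ n) (n : ℕ) :
    (conditionalLaw P (hpos x) (measurable_path hX x) : Measure (ℤ → Fin d → ℝ))
      {y | ∀ t, ν (y t) ≤ 2 ^ (n + Encodable.encode t)}ᶜ ≤
      ENNReal.ofReal c ^ n * (1 - ENNReal.ofReal c)⁻¹ := by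
  have hνm := ν.continuous_of_finiteDimensional.measurable
  have hset : {y : ℤ → Fin d → ℝ | ∀ t, ν (y t) ≤ 2 ^ (n + Encodable.encode t)}ᶜ =
      ⋃ t, {y : ℤ → Fin d → ℝ | 2 ^ (n + Encodable.encode t) < ν (y t)} := by
    ext y
    simp
  rw [hset]
  refine (measure_iUnion_le _).trans ?_
  have hterm : ∀ t : ℤ, (conditionalLaw P (hpos x) (measurable_path hX x) :
      Measure (ℤ → Fin d → ℝ)) {y | 2 ^ (n + Encodable.encode t) < ν (y t)} ≤
      ENNReal.ofReal c ^ n * ENNReal.ofReal c ^ Encodable.encode t := by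
    intro t
    have hm : MeasurableSet {y : ℤ → Fin d → ℝ | 2 ^ (n + Encodable.encode t) < ν (y t)} :=
      measurableSet_lt measurable_const (hνm.comp (measurable_pi_apply t))
    refine (conditionalLaw_apply_le (hpos x) _ hm).trans ?_
    rw [← pow_add, ← ENNReal.ofReal_pow hc.le]
    refine ENNReal.ofReal_le_ofReal (le_trans (le_of_eq ?_) (hgeo _))
    rw [← congrFun (hstat.upperTail_eq hX ν t) (2 ^ (n + Encodable.encode t) * x)]
    congr 2
    ext ω
    simp only [Set.mem_preimage, Set.mem_ofPred_eq]
    rw [ν.smul_pos _ (inv_pos.2 hx), inv_mul_eq_div, lt_div_iff₀ hx]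
  refine (ENNReal.tsum_le_tsum hterm).trans ?_
  rw [ENNReal.tsum_mul_left, ← ENNReal.tsum_geometric]
  exact mul_le_mul_right (ENNReal.tsum_comp_le_tsum_of_injective Encodable.encode_injective _) _

/-- Along `x → ∞`, the laws of the rescaled paths given `‖X_0‖ > x` have a cluster point. -/
theorem exists_mapClusterPt_conditionalLaw [IsProbabilityMeasure P] (hν : IsNorm ν)
    (hX : ∀ t, Measurable (X t)) (hstat : IsStrictlyStationary P X) (hα : 0 < α)
    (hRV : TailRV (upperTail P fun ω => ν (X 0 ω)) α)
    (hpos : ∀ x, 0 < upperTail P (fun ω => ν (X 0 ω)) x) :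
    ∃ Q : ProbabilityMeasure (ℤ → Fin d → ℝ), MapClusterPt Q atTop
      fun x => conditionalLaw P (hpos x) (measurable_path hX x) := by
  obtain ⟨c, x₀, hc0, hc1, hx₀, hgeo⟩ := hRV.exists_geometric_bound hα hpos
  have hc1' : ENNReal.ofReal c < 1 := by
    rw [← ENNReal.ofReal_one]
    exact (ENNReal.ofReal_lt_ofReal_iff one_pos).2 hc1
  have hfin : (1 - ENNReal.ofReal c)⁻¹ ≠ ⊤ := ENNReal.inv_ne_top.2 (tsub_pos_of_lt hc1').ne'
  let u : ℕ → NNReal := fun n => (ENNReal.ofReal c ^ n * (1 - ENNReal.ofReal c)⁻¹).toNNReal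
  have hufin : ∀ n, ENNReal.ofReal c ^ n * (1 - ENNReal.ofReal c)⁻¹ ≠ ⊤ := fun n =>
    ENNReal.mul_ne_top (ENNReal.pow_ne_top ENNReal.ofReal_ne_top) hfin
  have hu : Tendsto u atTop (𝓝 0) := by
    have h1 : Tendsto (fun n : ℕ => ENNReal.ofReal c ^ n * (1 - ENNReal.ofReal c)⁻¹) atTop
        (𝓝 (0 * (1 - ENNReal.ofReal c)⁻¹)) :=
      ENNReal.Tendsto.mul_const (ENNReal.tendsto_pow_atTop_nhds_zero_of_lt_one hc1')
        (Or.inr hfin)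
    rw [zero_mul] at h1
    exact (ENNReal.tendsto_toNNReal ENNReal.zero_ne_top).comp h1
  let K : ℕ → Set (ℤ → Fin d → ℝ) := fun n =>
    {y | ∀ t, ν (y t) ≤ 2 ^ (n + Encodable.encode t)}
  have hK : Monotone K := fun n m hnm y hy t =>
    (hy t).trans (pow_le_pow_right₀ one_le_two (by omega))
  have hcomp := isCompact_setOfPred_probabilityMeasure_mass_eq_compl_isCompact_le hu
    (fun n => isCompact_pi_seminorm_le hν fun t : ℤ => (2 : ℝ) ^ (n + Encodable.encode t))
    (Or.inr hK)
  -- The geometric bound is available only from `x₀` on; replacing `x` by `max x x₀` puts the whole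
  -- family in the compact set.
  obtain ⟨Q, -, hQ⟩ := hcomp.exists_mapClusterPt (f := atTop.map (fun x : ℝ => max x x₀))
    (u := fun x => conditionalLaw P (hpos x) (measurable_path hX x)) (by
      rw [le_principal_iff, mem_map, mem_map]
      refine Eventually.of_forall fun x n => ?_
      rw [← ENNReal.coe_le_coe, ProbabilityMeasure.ennreal_coeFn_eq_coeFn_toMeasure,
        ENNReal.coe_toNNReal (hufin n)]
      have hx : x₀ ≤ max x x₀ := le_max_right _ _
      exact conditionalLaw_path_compl_le hX hstat hpos hc0 (hx₀.trans_le hx) (hgeo _ hx) n)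
  have hmax : map (fun x : ℝ => max x x₀) atTop ≤ atTop :=
    tendsto_atTop_mono (fun x => le_max_left x x₀) tendsto_id
  exact ⟨Q, ClusterPt.mono hQ (map_mono hmax)⟩

/-- Let `a` increase and `b` decrease to `y`. At `y = 1` no `a` is available from below, and the
trivial bound `1` takes over. -/
theorem hasParetoNorm_of_ramp {Ω' : Type*} [MeasurableSpace Ω'] {Q : Measure Ω'}
    [IsProbabilityMeasure Q] {W : Ω' → (Fin d → ℝ)} (hW : Measurable W)
    (h : ∀ a b : ℝ, 1 ≤ a → a < b → b ^ (-α) ≤ ∫ ω, ramp a b (ν (W ω)) ∂Q ∧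
      ∫ ω, ramp a b (ν (W ω)) ∂Q ≤ a ^ (-α)) : HasParetoNorm Q ν W α := by
  have hνm := ν.continuous_of_finiteDimensional.measurable
  have hupper : ∀ a b : ℝ, 1 ≤ a → a < b → Q.real {ω | b < ν (W ω)} ≤ a ^ (-α) := by
    intro a b ha hab
    rw [← integral_indicator_gt hW]
    exact (integral_mono ((BddMeas.indicator_gt hνm b).integrable hW)
      ((bddMeas_ramp hνm a b).integrable hW) fun ω => indicator_le_ramp hab ν _).trans
      (h a b ha hab).2
  have hlower : ∀ a b : ℝ, 1 ≤ a → a < b → b ^ (-α) ≤ Q.real {ω | a < ν (W ω)} := by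
    intro a b ha hab
    rw [← integral_indicator_gt hW]
    exact (h a b ha hab).1.trans (integral_mono ((bddMeas_ramp hνm a b).integrable hW)
      ((BddMeas.indicator_gt hνm a).integrable hW) fun ω => ramp_le_indicator hab ν _)
  intro y hy
  have hy0 : 0 < y := by linarith
  have hcont : ContinuousAt (fun z : ℝ => z ^ (-α)) y := continuousAt_rpow_neg hy0
  have key : Q.real {ω | y < ν (W ω)} = y ^ (-α) := by
    refine le_antisymm ?_ ?_
    · rcases hy.eq_or_lt with rfl | hy1
      · rw [Real.one_rpow]
        exact measureReal_le_one
      · refine ge_of_tendsto (hcont.tendsto.mono_left (nhdsWithin_le_nhds (s := Set.Iio y))) ?_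
        filter_upwards [Ioo_mem_nhdsLT hy1] with a ha
        exact hupper a y ha.1.le ha.2
    · refine le_of_tendsto (hcont.tendsto.mono_left (nhdsWithin_le_nhds (s := Set.Ioi y))) ?_
      filter_upwards [self_mem_nhdsWithin] with b hb
      exact hlower y b hy hb
  rw [← key, Measure.real, ENNReal.ofReal_toReal (measure_ne_top _ _)]

/-- A single cluster point `Q` on path space serves all windows at once: convergence of the
integrals over each window forces the limits to be the integrals against the marginals of `Q`. -/
theorem HasBlockTailLimits.exists_tail [IsProbabilityMeasure P] (hν : IsNorm ν)
    (hX : ∀ t, Measurable (X t)) (hstat : IsStrictlyStationary P X) (hα : 0 < α)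
    (h : HasBlockTailLimits P ν X α) :
    ∃ (Ω' : Type) (_ : MeasurableSpace Ω') (Q : Measure Ω') (_ : IsProbabilityMeasure Q)
      (Y : ℤ → Ω' → (Fin d → ℝ)), IsTailProcess P ν X α Q Y := by
  have hRV := h.1
  have hνm := ν.continuous_of_finiteDimensional.measurable
  have hpos := hRV.pos (upperTail_anti P _) (upperTail_nonneg P _)
  obtain ⟨Q, hQ⟩ := exists_mapClusterPt_conditionalLaw hν hX hstat hα hRV hpos
  have hconv : ∀ (s t : ℤ) (f : BoundedContinuousFunction (Finset.Icc s t → Fin d → ℝ) ℝ),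
      Tendsto (fun x => ∫ v, f v ∂(exceedanceLaw P ν X
        (fun i : Finset.Icc s t => (i : ℤ)) x : Measure (Finset.Icc s t → Fin d → ℝ)))
      atTop (𝓝 (∫ y, f (fun i => y i) ∂(Q : Measure (ℤ → Fin d → ℝ)))) := by
    intro s t f
    obtain ⟨l, hl⟩ := h.exists_tendsto_exceedanceLaw hX hstat hα s t f
    have hr : Continuous fun (y : ℤ → Fin d → ℝ) (i : Finset.Icc s t) => y i :=
      continuous_pi fun i => continuous_apply _
    have := hQ.integral_eq (f.compContinuous ⟨_, hr⟩) (l := l) (hl.congr fun x => ?_)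
    · rw [← this] at hl
      exact hl
    · rw [integral_exceedanceLaw hX _ f.continuous.measurable,
        integral_conditionalLaw (hpos x) _ (BoundedContinuousFunction.continuous _).measurable]
      rfl
  refine ⟨ℤ → Fin d → ℝ, inferInstance, Q, inferInstance, fun t y => y t,
    fun t => measurable_pi_apply t, hasParetoNorm_of_ramp (measurable_pi_apply 0) ?_,
    fun s t _ => FiniteMeasure.tendsto_iff_forall_integral_tendsto.2 fun f => ?_⟩
  · intro a b ha hab
    let i₀ : Finset.Icc (0 : ℤ) 0 := ⟨0, by simp⟩
    let f : BoundedContinuousFunction (Finset.Icc (0 : ℤ) 0 → Fin d → ℝ) ℝ :=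
      BoundedContinuousFunction.ofNormedAddCommGroup (fun v => ramp a b (ν (v i₀)))
        (continuous_ramp_comp_apply ν a b i₀) 1 fun v => abs_ramp_le_one _ _ _
    have hl : Tendsto (scaledMean P (X 0) (upperTail P fun ω => ν (X 0 ω))
        fun v => ramp a b (ν v)) atTop
        (𝓝 (∫ y, ramp a b (ν (y 0)) ∂(Q : Measure (ℤ → Fin d → ℝ)))) := by
      refine (hconv 0 0 f).congr' ?_
      filter_upwards [eventually_gt_atTop 0] with x hx
      exact exceedanceLaw_eq_scaledMean_ramp hX ha hab _ i₀ rfl hx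
    constructor
    · refine le_of_tendsto_of_tendsto (hRV b (by linarith)) hl ?_
      filter_upwards [eventually_gt_atTop 0] with x hx
      rw [← scaledMean_indicator_one hνm ν.smul_pos (hX 0) b hx]
      exact scaledMean_mono (BddMeas.indicator_gt hνm _) (bddMeas_ramp hνm _ _) (hX 0)
        (upperTail_nonneg _ _) (fun v => indicator_le_ramp hab ν v) x
    · refine le_of_tendsto_of_tendsto hl (hRV a (by linarith)) ?_
      filter_upwards [eventually_gt_atTop 0] with x hx
      rw [← scaledMean_indicator_one hνm ν.smul_pos (hX 0) a hx]
      exact scaledMean_mono (bddMeas_ramp hνm _ _) (BddMeas.indicator_gt hνm _) (hX 0)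
        (upperTail_nonneg _ _) (fun v => ramp_le_indicator hab ν v) x
  · rw [integral_finiteLaw (measurable_pi_lambda _ fun i => measurable_pi_apply _)
      f.continuous.measurable]
    exact hconv s t f

theorem IsTailProcess.forward {Ω' : Type*} [MeasurableSpace Ω'] {Q : Measure Ω'}
    [IsProbabilityMeasure Q] {Y : ℤ → Ω' → (Fin d → ℝ)} (hX : ∀ t, Measurable (X t))
    (h : IsTailProcess P ν X α Q Y) :
    IsForwardTailProcess P ν X α Q fun t : ℕ => Y t := by
  obtain ⟨hY, hpar, hconv⟩ := h
  refine ⟨fun t => hY t, hpar, fun t =>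
    FiniteMeasure.tendsto_iff_forall_integral_tendsto.2 fun f => ?_⟩
  have hidx : ∀ i : Fin (t + 1), ((i : ℕ) : ℤ) ∈ Finset.Icc (0 : ℤ) t := fun i => by
    rw [Finset.mem_Icc]
    omega
  have hr : Continuous fun (v : Finset.Icc (0 : ℤ) t → Fin d → ℝ) (i : Fin (t + 1)) =>
      v ⟨_, hidx i⟩ := continuous_pi fun i => continuous_apply _
  have h1 := FiniteMeasure.tendsto_iff_forall_integral_tendsto.1
    (hconv 0 t (Int.natCast_nonneg t)) (f.compContinuous ⟨_, hr⟩)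
  rw [integral_finiteLaw (measurable_pi_lambda _ fun i => hY _)
    (BoundedContinuousFunction.continuous _).measurable] at h1
  rw [integral_finiteLaw (measurable_pi_lambda _ fun i => hY _) f.continuous.measurable]
  refine h1.congr fun x => ?_
  rw [integral_exceedanceLaw hX _ (BoundedContinuousFunction.continuous _).measurable,
    integral_exceedanceLaw hX _ f.continuous.measurable]
  rfl

end

/-! ### The equivalence of the three statements -/

theorem theorem2p1 {Ω : Type*} [MeasurableSpace Ω] (P : Measure Ω) [IsProbabilityMeasure P]
    (d : ℕ) (ν : Seminorm ℝ (Fin d → ℝ)) (hν : IsNorm ν)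
    (X : ℤ → Ω → (Fin d → ℝ)) (hX : ∀ t, Measurable (X t)) (hstat : IsStrictlyStationary P X)
    (α : ℝ) (hα : 0 < α) :
    List.TFAE [
      IsJointlyRegularlyVarying P X α,
      ∃ (Ω' : Type) (_ : MeasurableSpace Ω') (Q : Measure Ω') (_ : IsProbabilityMeasure Q)
        (Y : ℕ → Ω' → (Fin d → ℝ)), IsForwardTailProcess P ν X α Q Y,
      ∃ (Ω' : Type) (_ : MeasurableSpace Ω') (Q : Measure Ω') (_ : IsProbabilityMeasure Q)
        (Y : ℤ → Ω' → (Fin d → ℝ)), IsTailProcess P ν X α Q Y] := by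
  tfae_have 1 → 3 := fun h =>
    (h.hasBlockTailLimits hν hX hstat hα).exists_tail hν hX hstat hα
  tfae_have 3 → 2 := fun ⟨Ω', _, Q, _, Y, hY⟩ =>
    ⟨Ω', inferInstance, Q, inferInstance, fun t : ℕ => Y t, hY.forward hX⟩
  tfae_have 2 → 1 := fun ⟨_, _, _, _, _, hY⟩ =>
    (hY.hasBlockTailLimits hν hX hstat hα).isJointlyRegularlyVarying hν hX hstat hα
  tfae_finish
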